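/- For an integer $q\ge 3$ and a real number $t>0$ let \[\Delta(t,q)=\sup_{\chi\ne\chi_0 \bmod q}\Big|\sum_{1\le n\le t}\chi(n)\Big|,\] the supremum being taken over all non-principal Dirichlet characters modulo $q$. Write $\log_2 q=\log\log q$ and $\log_3 q=\log\log\log q$. Let $\varepsilon>0$ be fixed, let $q$ be a large integer, and let $N=q^{\theta}$ be a real number with $\theta<1-\varepsilon$ and $\log N>4\sqrt{\log q\,\log_2 q}\,\log_3 q$. Then \[\Delta(N,q)\ \ge\ \sqrt N\,\exp\left((1+o(1))\sqrt{\frac{(1-\theta)\log q}{\log_2 q}}\right).\] If in addition $q$ is prime, then \[\Delta\left(\frac qN,q\right)\ \ge\ \sqrt{\frac qN}\,\exp\left((1+o(1))\sqrt{\frac{(1-\theta)\log q}{2\log_2 q}}\right).\] Here $o(1)$ tends to $0$ as $q\to\infty$, for each fixed $\varepsilon$ and uniformly in $N$. That is, for all $\varepsilon,\delta>0$ there is $q_0=q_0(\varepsilon,\delta)$ such that for all $q\ge q_0$ and all such $N$ and $\theta$ the first bound holds with $1-\delta$ in place of $1+o(1)$, and, if $q$ is prime, so does the second. -/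

import Mathlib

/-- `charSumSup t q` is `Δ(t, q)`: the supremum, over all non-principal Dirichlet characters `χ`
modulo `q`, of `|∑_{n ≤ t} χ(n)|`, where `t` is a real number and `n` runs over the positive
integers up to `t`. (There are finitely many characters, so for `q ≥ 3` this is a maximum.) -/
noncomputable def charSumSup (t : ℝ) (q : ℕ) : ℝ :=
  ⨆ χ : {χ : DirichletCharacter ℂ q // χ ≠ 1},
    ‖∑ n ∈ Finset.Icc 1 ⌊t⌋₊, (χ : DirichletCharacter ℂ q) (n : ZMod q)‖

/-!
The proof is by the resonance method. Write `S(χ) = ∑_{n ≤ t} χ(n)` and, for nonnegative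
coefficients `r(m)`, `m ≤ y`, let `R(χ) = ∑ r(m) χ(m)`. Then `Δ(t, q)²` is at least the quotient of
`∑_{χ ≠ χ₀} |S(χ) R(χ)|²` by `∑_χ |R(χ)|²`. By orthogonality the denominator is `φ(q) ∑ r(m)²` when
`y < q`, and the sum over all `χ` of `|S(χ) R(χ)|²` is `φ(q)` times the weighted number of solutions
of `n₁ m₁ ≡ n₂ m₂ (mod q)`.

**The resonator.** With `x = log q`, `r` is supported on the squarefree `m ≤ y` composed of primes
`p ∤ q`, `x < p ≤ x ^ K`, where `r` is multiplicative with `r(p) = L / (√p log p)`. Let `σ` be the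
sum of `1 / (p log p)` over these primes. Mertens' theorem gives `σ ≥ (1 - η) / log x`
(`exists_sum_resonatorPrimes_ge`), and `L` is chosen with `L² σ = (1 - η) log y`, so that Rankin's
trick shows that the condition `m ≤ y` is harmless. Because the primes reach only up to a fixed power
of `x`, the quotients of two typical `m` by their greatest common divisor are small compared with
`N`, and Rankin's trick disposes of the other pairs too (`sum_large_quotient_le`).

**The solutions of the equation.** The weighted number of solutions of `n₁ m₁ = n₂ m₂`, `n₁, n₂ ≤ W`,
is `∑_c A(c)²` with `A(c)` the sum of `r(m)` over the factorizations `c = n m`. By Cauchy–Schwarz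
it is bounded below by pairing `A` with the coefficients `r(m)` placed at the integers `k m`, for
auxiliary primes `k` (`card_mul_sq_le_collisionSum`). Up to powers of `log q` the outcome is `W ∑ r²`
times the square of `∏ (1 + r(p) / √p) ≈ exp(L σ)`, and `L σ ≥ (1 - η) √(log y / log x)`. These
facts are collected in `exists_resonator`.

**Sums of length `N`.** Here `y = q / N`. Every solution of the congruence has nonnegative weight, so
keeping those of the equation gives a lower bound, and by Cauchy–Schwarz the principal character
contributes at most `N² y ∑ r²`, which is negligible (`collisionSum_le`, `le_charSumSup_sq`).

**Sums of length `X = q / N`, for `q` prime.** Here `y = √(q / N)`, and the contribution of `χ₀` has to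
be compared with the off-diagonal solutions. For given `m₁, m₂`, let `A` be the larger of their
quotients by their greatest common divisor. If `A ≤ N / 8`, the `≈ X / A` solutions of the equation
outweigh the expected number `X² / q`. If `A` is larger, the number of solutions of the congruence is
at least `X² / q - 2 X A / q - 2 X / A` (`congruenceCount_ge`); the sum of the term `X A / q` over
the pairs is negligible as `y² ≤ q / N`, and that of `X / A` by the bound for the pairs with a large
quotient.
-/

/-! ### Mertens' first theorem -/

theorem log_factorial_eq_sum_primes (n : ℕ) :
    Real.log (n.factorial) =
      ∑ p ∈ Nat.primesLE n, (n.factorial.factorization p : ℝ) * Real.log p := by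
  have h := Nat.prod_factorization_pow_eq_self (Nat.factorial_ne_zero n)
  have h2 : (n.factorial : ℝ) = ∏ p ∈ Nat.primesLE n, (p : ℝ) ^ (n.factorial.factorization p) := by
    conv_lhs => rw [← h]
    rw [Finsupp.prod_of_support_subset (s := Nat.primesLE n)]
    · push_cast; rfl
    · intro p hp
      have hp1 := Nat.prime_of_mem_primeFactors (by simpa using hp)
      have hp2 := Nat.dvd_of_mem_primeFactors (by simpa using hp : p ∈ n.factorial.primeFactors)
      exact Nat.mem_primesLE.2 ⟨(hp1.dvd_factorial).1 hp2, hp1⟩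
    · simp
  rw [h2, Real.log_prod]
  · exact Finset.sum_congr rfl fun p _ => by rw [Real.log_pow]
  · intro p hp
    have := (Nat.prime_of_mem_primesLE hp).pos
    positivity

theorem div_le_factorization_factorial {n p : ℕ} (hp : p.Prime) :
    n / p ≤ n.factorial.factorization p := by
  have := Fact.mk hp
  rw [Nat.factorization_def _ hp, padicValNat_factorial (Nat.lt_succ_of_le (le_max_left _ 1))]
  have h1 : 1 ∈ Finset.Ico 1 (max (Nat.log p n) 1).succ := by simp
  simpa using Finset.single_le_sum (f := fun i => n / p ^ i) (fun _ _ => Nat.zero_le _) h1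

theorem factorization_factorial_mul_le {n p : ℕ} (hp : p.Prime) :
    (p - 1) * n.factorial.factorization p ≤ n := by
  have := Fact.mk hp
  rw [Nat.factorization_def _ hp, sub_one_mul_padicValNat_factorial]
  exact Nat.sub_le _ _

theorem log_le_two_mul_sqrt {x : ℝ} (hx : 0 < x) : Real.log x ≤ 2 * √x := by
  have h := Real.log_le_sub_one_of_pos (Real.sqrt_pos.2 hx)
  rw [Real.log_sqrt hx.le] at h
  linarith

/-- The sum over primes that separates `1 / p` from `1 / (p - 1)` in Mertens' first theorem is
bounded. -/
theorem exists_sum_log_div_mul_le :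
    ∃ C : ℝ, 0 ≤ C ∧ ∀ n : ℕ,
      ∑ p ∈ Nat.primesLE n, Real.log p / ((p : ℝ) * ((p : ℝ) - 1)) ≤ C := by
  have hs : Summable fun n : ℕ => 4 * (1 / (n : ℝ) ^ (3 / 2 : ℝ)) :=
    (Real.summable_one_div_nat_rpow.2 (by norm_num)).mul_left 4
  refine ⟨∑' n : ℕ, 4 * (1 / (n : ℝ) ^ (3 / 2 : ℝ)), tsum_nonneg fun n => by positivity,
    fun n => ?_⟩
  refine le_trans (Finset.sum_le_sum fun p hp => ?_)
    (hs.sum_le_tsum (Nat.primesLE n) (fun i _ => by positivity))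
  have h2 : (2 : ℝ) ≤ p := by exact_mod_cast Nat.two_le_of_mem_primesLE hp
  have h0 : (0 : ℝ) < p := by linarith
  have hp32 : (p : ℝ) ^ (3 / 2 : ℝ) = p * √p := by
    rw [show (3 / 2 : ℝ) = 1 + 1 / 2 by norm_num, Real.rpow_add h0, Real.rpow_one,
      ← Real.sqrt_eq_rpow]
  have hsq : √(p : ℝ) * √p = p := Real.mul_self_sqrt h0.le
  have hs0 : 0 < √(p : ℝ) := Real.sqrt_pos.2 h0
  rw [hp32, mul_one_div, div_le_div_iff₀ (by nlinarith) (by positivity)]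
  have hl := log_le_two_mul_sqrt h0
  calc Real.log p * (p * √p) ≤ 2 * √p * (p * √p) := by gcongr
    _ = 2 * ((√(p : ℝ) * √p) * p) := by ring
    _ = 2 * (p * p) := by rw [hsq]
    _ ≤ 4 * (p * (p - 1)) := by nlinarith

/-- Mertens' first theorem. -/
theorem exists_abs_sum_log_div_sub_log_le :
    ∃ C : ℝ, 0 ≤ C ∧ ∀ n : ℕ, n ≠ 0 →
      |∑ p ∈ Nat.primesLE n, Real.log p / (p : ℝ) - Real.log n| ≤ C := by
  obtain ⟨C, hC0, hC⟩ := exists_sum_log_div_mul_le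
  refine ⟨C + 1 + Real.log 4, by positivity, fun n hn => ?_⟩
  have hn0 : (0 : ℝ) < n := by exact_mod_cast Nat.pos_of_ne_zero hn
  have hfac := log_factorial_eq_sum_primes n
  have hl4 : 0 ≤ Real.log 4 := Real.log_nonneg (by norm_num)
  rw [abs_le]
  constructor
  · have hst := Stirling.le_log_factorial_stirling hn
    have hln : 0 ≤ Real.log n := Real.log_natCast_nonneg n
    have hpi : 0 ≤ Real.log (2 * Real.pi) := Real.log_nonneg (by nlinarith [Real.pi_gt_three])
    have hup : Real.log (n.factorial) ≤
        n * (∑ p ∈ Nat.primesLE n, Real.log p / (p : ℝ)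
          + ∑ p ∈ Nat.primesLE n, Real.log p / ((p : ℝ) * ((p : ℝ) - 1))) := by
      rw [hfac, ← Finset.sum_add_distrib, Finset.mul_sum]
      refine Finset.sum_le_sum fun p hp => ?_
      have h2 : (2 : ℝ) ≤ p := by exact_mod_cast Nat.two_le_of_mem_primesLE hp
      have hpp := Nat.prime_of_mem_primesLE hp
      have hlp : 0 ≤ Real.log p := Real.log_natCast_nonneg p
      have h := factorization_factorial_mul_le (n := n) hpp
      have h' : ((p : ℝ) - 1) * n.factorial.factorization p ≤ n := by
        have := (Nat.cast_le (α := ℝ)).2 h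
        rwa [Nat.cast_mul, Nat.cast_sub hpp.one_le, Nat.cast_one] at this
      have hp1 : (0 : ℝ) < p - 1 := by linarith
      have hp0 : (0 : ℝ) < p := by linarith
      have : (n : ℝ) * (Real.log p / p + Real.log p / (p * (p - 1)))
          = (n / (p - 1)) * Real.log p := by
        field_simp; ring
      rw [this]
      gcongr
      rw [le_div_iff₀ hp1]; linarith
    have hCn := hC n
    have : (n : ℝ) * Real.log n - n ≤ n * (∑ p ∈ Nat.primesLE n, Real.log p / (p : ℝ) + C) := by
      have : (n : ℝ) * (∑ p ∈ Nat.primesLE n, Real.log p / (p : ℝ)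
          + ∑ p ∈ Nat.primesLE n, Real.log p / ((p : ℝ) * ((p : ℝ) - 1))) ≤
          n * (∑ p ∈ Nat.primesLE n, Real.log p / (p : ℝ) + C) := by gcongr
      linarith
    have h3 : (n : ℝ) * (Real.log n - 1) ≤
        n * (∑ p ∈ Nat.primesLE n, Real.log p / (p : ℝ) + C) := by linarith
    have := le_of_mul_le_mul_left h3 hn0
    linarith
  · have hlow : (n : ℝ) * ∑ p ∈ Nat.primesLE n, Real.log p / (p : ℝ)
        - ∑ p ∈ Nat.primesLE n, Real.log p ≤ Real.log (n.factorial) := by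
      rw [hfac, Finset.mul_sum, ← Finset.sum_sub_distrib]
      refine Finset.sum_le_sum fun p hp => ?_
      have hpp := Nat.prime_of_mem_primesLE hp
      have hp0 : (0 : ℝ) < p := by exact_mod_cast hpp.pos
      have hlp : 0 ≤ Real.log p := Real.log_natCast_nonneg p
      have h1 : ((n / p : ℕ) : ℝ) ≤ n.factorial.factorization p := by
        exact_mod_cast div_le_factorization_factorial hpp
      have h2 : (n : ℝ) / p < (n / p : ℕ) + 1 := by
        rw [div_lt_iff₀ hp0]
        have := Nat.lt_div_mul_add (a := n) hpp.pos
        have h3 : n < (n / p + 1) * p := by rw [add_mul, one_mul]; exact this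
        exact_mod_cast h3
      have : (n : ℝ) * (Real.log p / p) - Real.log p = (n / p - 1) * Real.log p := by
        field_simp
      rw [this]
      gcongr
      linarith
    have hth : ∑ p ∈ Nat.primesLE n, Real.log p ≤ Real.log 4 * n := by
      rw [← Chebyshev.theta_eq_sum_primesLE_log]
      exact Chebyshev.theta_le_log4_mul_x hn0.le
    have hfl : Real.log (n.factorial) ≤ n * Real.log n := by
      rw [← Real.log_pow]
      apply Real.log_le_log (by exact_mod_cast Nat.factorial_pos n)
      exact_mod_cast Nat.factorial_le_pow n
    have h3 : (n : ℝ) * ∑ p ∈ Nat.primesLE n, Real.log p / (p : ℝ) ≤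
        n * (Real.log n + Real.log 4) := by linarith
    have := le_of_mul_le_mul_left h3 hn0
    linarith

/-! ### Sums of `1 / (p log p)` over the primes of an interval -/

/-- The primes `p` with `u < p ≤ v`, for real `u` and `v`. -/
noncomputable def primesIoc (u v : ℝ) : Finset ℕ :=
  (Nat.primesLE ⌊v⌋₊).filter fun p => u < (p : ℝ)

theorem mem_primesIoc {u v : ℝ} {p : ℕ} (hv : 0 ≤ v) :
    p ∈ primesIoc u v ↔ p.Prime ∧ u < p ∧ (p : ℝ) ≤ v := by
  rw [primesIoc, Finset.mem_filter, Nat.mem_primesLE, Nat.le_floor_iff hv]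
  tauto

theorem sum_primesIoc_add (g : ℕ → ℝ) {u v w : ℝ} (hu : 0 ≤ u) (huv : u ≤ v) (hvw : v ≤ w) :
    ∑ p ∈ primesIoc u w, g p = ∑ p ∈ primesIoc u v, g p + ∑ p ∈ primesIoc v w, g p := by
  have hv := hu.trans huv
  have hw := hv.trans hvw
  rw [← Finset.sum_union]
  · congr 1
    ext p
    simp only [Finset.mem_union, mem_primesIoc hv, mem_primesIoc hw]
    constructor
    · rintro ⟨h1, h2, h3⟩
      rcases le_or_gt (p : ℝ) v with h | h
      · exact Or.inl ⟨h1, h2, h⟩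
      · exact Or.inr ⟨h1, h, h3⟩
    · rintro (⟨h1, h2, h3⟩ | ⟨h1, h2, h3⟩)
      · exact ⟨h1, h2, h3.trans hvw⟩
      · exact ⟨h1, huv.trans_lt h2, h3⟩
  · rw [Finset.disjoint_left]
    intro p hp hp'
    rw [mem_primesIoc hv] at hp
    rw [mem_primesIoc hw] at hp'
    linarith [hp.2.2, hp'.2.1]

/-- Mertens' first theorem over the primes of an interval. -/
theorem exists_abs_sum_primesIoc_sub_le :
    ∃ C : ℝ, 0 ≤ C ∧ ∀ u v : ℝ, 1 ≤ u → u ≤ v →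
      |∑ p ∈ primesIoc u v, Real.log p / (p : ℝ) - (Real.log v - Real.log u)| ≤ C := by
  obtain ⟨C, hC0, hC⟩ := exists_abs_sum_log_div_sub_log_le
  have key : ∀ t : ℝ, 1 ≤ t →
      |∑ p ∈ primesIoc 0 t, Real.log p / (p : ℝ) - Real.log t| ≤ C + Real.log 2 := by
    intro t ht
    have hf : 1 ≤ ⌊t⌋₊ := Nat.le_floor (by exact_mod_cast ht)
    have hset : primesIoc 0 t = Nat.primesLE ⌊t⌋₊ := by
      refine Finset.filter_true_of_mem fun p hp => ?_
      exact_mod_cast (Nat.prime_of_mem_primesLE hp).pos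
    rw [hset]
    have h1 := hC ⌊t⌋₊ (by omega)
    have hf1 : (1 : ℝ) ≤ ⌊t⌋₊ := by exact_mod_cast hf
    have h2 : Real.log ⌊t⌋₊ ≤ Real.log t :=
      Real.log_le_log (by linarith) (Nat.floor_le (by linarith))
    have h3 : Real.log t ≤ Real.log 2 + Real.log ⌊t⌋₊ := by
      rw [← Real.log_mul (by norm_num) (by linarith)]
      exact Real.log_le_log (by linarith) (by linarith [Nat.lt_floor_add_one t])
    rw [abs_le] at h1 ⊢
    have := Real.log_nonneg (show (1 : ℝ) ≤ 2 by norm_num)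
    constructor <;> linarith [h1.1, h1.2]
  refine ⟨2 * (C + Real.log 2), by
    have := Real.log_nonneg (show (1 : ℝ) ≤ 2 by norm_num); positivity, fun u v hu huv => ?_⟩
  have h := sum_primesIoc_add (fun p => Real.log p / (p : ℝ)) (le_refl 0) (by linarith : 0 ≤ u) huv
  have h1 := key u hu
  have h2 := key v (hu.trans huv)
  rw [abs_le] at h1 h2 ⊢
  constructor <;> linarith [h1.1, h1.2, h2.1, h2.2]

/-- The sum of `1 / (p log p)` over `x < p ≤ x ^ c ^ n`, by Mertens' theorem on each of the
intervals `(x ^ c ^ i, x ^ c ^ (i + 1)]`. -/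
theorem exists_sum_one_div_mul_log_ge :
    ∃ C : ℝ, 0 ≤ C ∧ ∀ (c : ℝ), 1 < c → ∀ (x : ℝ), 1 < x → ∀ n : ℕ,
      (1 - (c ^ n)⁻¹) / (c * Real.log x) - C * n / Real.log x ^ 2 ≤
        ∑ p ∈ primesIoc x (x ^ (c ^ n)), 1 / ((p : ℝ) * Real.log p) := by
  obtain ⟨C, hC0, hC⟩ := exists_abs_sum_primesIoc_sub_le
  refine ⟨C, hC0, fun c hc x hx n => ?_⟩
  have hx0 : 0 < x := by linarith
  have hlx : 0 < Real.log x := Real.log_pos hx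
  induction n with
  | zero => simp only [pow_zero, inv_one, sub_self, zero_div, Nat.cast_zero, mul_zero]
            exact Finset.sum_nonneg fun p _ => by
              have := Real.log_natCast_nonneg p
              positivity
  | succ n ih =>
    set u := x ^ (c ^ n) with hu
    set v := x ^ (c ^ (n + 1)) with hv
    have hcn : 1 ≤ c ^ n := one_le_pow₀ hc.le
    have hxu : x ≤ u := Real.self_le_rpow_of_one_le hx.le hcn
    have huv : u ≤ v :=
      Real.rpow_le_rpow_of_exponent_le hx.le (pow_le_pow_right₀ hc.le (Nat.le_succ n))
    rw [sum_primesIoc_add _ hx0.le hxu huv]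
    have hlu : Real.log u = c ^ n * Real.log x := Real.log_rpow hx0 _
    have hlv : Real.log v = c ^ (n + 1) * Real.log x := Real.log_rpow hx0 _
    have hlv0 : 0 < Real.log v := by rw [hlv]; positivity
    have hm := (abs_le.1 (hC u v (by linarith) huv)).1
    have hstep : (∑ p ∈ primesIoc u v, Real.log p / (p : ℝ)) / Real.log v ^ 2 ≤
        ∑ p ∈ primesIoc u v, 1 / ((p : ℝ) * Real.log p) := by
      rw [Finset.sum_div]
      refine Finset.sum_le_sum fun p hp => ?_
      rw [mem_primesIoc (by linarith)] at hp
      have hp0 : (0 : ℝ) < p := by linarith [hp.2.1]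
      have hlp : 0 < Real.log p := Real.log_pos (by linarith [hp.2.1])
      have hlpv : Real.log p ≤ Real.log v := Real.log_le_log hp0 hp.2.2
      rw [div_div, div_le_div_iff₀ (by positivity) (by positivity), one_mul]
      calc Real.log p * (p * Real.log p) = p * Real.log p ^ 2 := by ring
        _ ≤ p * Real.log v ^ 2 := by gcongr
    have hfin : (1 - (c ^ (n + 1))⁻¹) / (c * Real.log x) - C * (n + 1 : ℕ) / Real.log x ^ 2
        ≤ (1 - (c ^ n)⁻¹) / (c * Real.log x) - C * n / Real.log x ^ 2
          + (c ^ (n + 1) * Real.log x - c ^ n * Real.log x - C) / Real.log v ^ 2 := by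
      have e1 : (c ^ (n + 1) * Real.log x - c ^ n * Real.log x - C) / Real.log v ^ 2 =
          (1 - (c ^ (n + 1))⁻¹) / (c * Real.log x) - (1 - (c ^ n)⁻¹) / (c * Real.log x)
            - C / Real.log v ^ 2 := by
        rw [hlv]
        have : c ≠ 0 := by linarith
        field_simp
        ring
      have e2 : C / Real.log v ^ 2 ≤ C / Real.log x ^ 2 := by
        have : Real.log x ≤ Real.log v := Real.log_le_log hx0 (hxu.trans huv)
        gcongr
      rw [e1]
      push_cast
      have : C * ((n : ℝ) + 1) / Real.log x ^ 2 = C * n / Real.log x ^ 2 + C / Real.log x ^ 2 := by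
        ring
      rw [this]
      linarith
    have h4 : (c ^ (n + 1) * Real.log x - c ^ n * Real.log x - C) / Real.log v ^ 2 ≤
        (∑ p ∈ primesIoc u v, Real.log p / (p : ℝ)) / Real.log v ^ 2 := by
      gcongr
      rw [← hlu, ← hlv]; linarith
    linarith

/-- `∑ 1 / (p log p)` over `x < p ≤ x ^ K` is at least `(1 - η) / log x`, once `K` is large in
terms of `η`, and `x` in terms of `K`. -/
theorem exists_sum_primesIoc_ge {η : ℝ} (hη : 0 < η) :
    ∃ K : ℝ, 1 ≤ K ∧ ∃ x₀ : ℝ, ∀ x : ℝ, x₀ ≤ x →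
      (1 - η) / Real.log x ≤ ∑ p ∈ primesIoc x (x ^ K), 1 / ((p : ℝ) * Real.log p) := by
  obtain ⟨C, hC0, hC⟩ := exists_sum_one_div_mul_log_ge
  -- the intervals `(x ^ c ^ i, x ^ c ^ (i + 1)]` lose a factor `c`, and those beyond the `n`-th
  -- a proportion `c ^ (-n) ≤ η / 4`
  set c := 1 + η / 4 with hc
  have hc1 : 1 < c := by linarith
  obtain ⟨n, hn⟩ := pow_unbounded_of_one_lt (4 / η) hc1
  refine ⟨c ^ n, one_le_pow₀ hc1.le, max 2 (Real.exp (C * n * 4 / η)), fun x hx => ?_⟩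
  have hx2 : 2 ≤ x := (le_max_left _ _).trans hx
  have hlx : 0 < Real.log x := Real.log_pos (by linarith)
  have hlx2 : C * n * 4 / η ≤ Real.log x := by
    rw [Real.le_log_iff_exp_le (by linarith)]
    exact (le_max_right _ _).trans hx
  refine le_trans ?_ (hC c hc1 x (by linarith) n)
  have h1 : (c ^ n)⁻¹ ≤ η / 4 := by
    rw [inv_le_comm₀ (by positivity) (by positivity), inv_div]
    exact hn.le
  have h2 : C * n / Real.log x ^ 2 ≤ (η / 4) / Real.log x := by
    rw [div_le_div_iff₀ (by positivity) hlx]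
    have : C * n ≤ η / 4 * Real.log x := by
      rw [div_le_iff₀ hη] at hlx2; linarith
    calc C * n * Real.log x ≤ η / 4 * Real.log x * Real.log x := by gcongr
      _ = _ := by ring
  have h3 : (1 - η / 2) / Real.log x ≤ (1 - (c ^ n)⁻¹) / (c * Real.log x) := by
    rw [div_le_div_iff₀ hlx (by positivity)]
    have : (1 - η / 2) * c ≤ 1 - (c ^ n)⁻¹ := by rw [hc]; nlinarith
    calc (1 - η / 2) * (c * Real.log x) = ((1 - η / 2) * c) * Real.log x := by ring
      _ ≤ _ := by gcongr
  have h4 : (1 - η) / Real.log x ≤ (1 - η / 2) / Real.log x - (η / 4) / Real.log x := by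
    rw [← sub_div]
    exact div_le_div_of_nonneg_right (by linarith) hlx.le
  linarith

/-- `∑ 1 / (p log p)` over `x < p ≤ x ^ K` is `O_K(1 / log x)`. -/
theorem exists_sum_primesIoc_le {K : ℝ} (hK : 1 ≤ K) :
    ∃ C : ℝ, 0 < C ∧ ∃ x₀ : ℝ, ∀ x : ℝ, x₀ ≤ x →
      ∑ p ∈ primesIoc x (x ^ K), 1 / ((p : ℝ) * Real.log p) ≤ C / Real.log x := by
  obtain ⟨C, hC0, hC⟩ := exists_abs_sum_primesIoc_sub_le
  refine ⟨K + C, by positivity, Real.exp 1, fun x hx => ?_⟩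
  have hx1 : 1 < x := lt_of_lt_of_le (by rw [Real.one_lt_exp_iff]; norm_num) hx
  have hx0 : 0 < x := by linarith
  have hlx1 : 1 ≤ Real.log x := by rwa [Real.le_log_iff_exp_le hx0]
  have hxK : x ≤ x ^ K := Real.self_le_rpow_of_one_le hx1.le hK
  have hm := (abs_le.1 (hC x (x ^ K) hx1.le hxK)).2
  rw [Real.log_rpow hx0] at hm
  have : ∑ p ∈ primesIoc x (x ^ K), 1 / ((p : ℝ) * Real.log p) ≤
      (∑ p ∈ primesIoc x (x ^ K), Real.log p / (p : ℝ)) / Real.log x ^ 2 := by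
    rw [Finset.sum_div]
    refine Finset.sum_le_sum fun p hp => ?_
    rw [mem_primesIoc (by linarith)] at hp
    have hp0 : (0 : ℝ) < p := by linarith [hp.2.1]
    have hlp : Real.log x ≤ Real.log p := Real.log_le_log hx0 hp.2.1.le
    have hlp0 : 0 < Real.log p := by linarith
    rw [div_div, div_le_div_iff₀ (by positivity) (by positivity), one_mul]
    calc (p : ℝ) * Real.log x ^ 2 ≤ p * Real.log p ^ 2 := by gcongr
      _ = _ := by ring
  refine this.trans ?_
  rw [div_le_div_iff₀ (by positivity) (by positivity)]
  calc (∑ p ∈ primesIoc x (x ^ K), Real.log p / (p : ℝ)) * Real.log x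
      ≤ (K * Real.log x + C) * Real.log x := by gcongr; linarith
    _ ≤ (K * Real.log x + C * Real.log x) * Real.log x := by
        gcongr; exact le_mul_of_one_le_right hC0 hlx1
    _ = _ := by ring

/-! ### The primes not dividing `q` -/

/-- A positive integer `q` has at most `log q / log x` prime factors exceeding `x`. -/
theorem card_primeFactors_gt_mul_log_le {q : ℕ} (hq : q ≠ 0) {x : ℝ} (hx : 0 < x) :
    ((q.primeFactors.filter fun p : ℕ => x < (p : ℝ)).card : ℝ) * Real.log x ≤ Real.log q := by
  set s := q.primeFactors.filter fun p : ℕ => x < (p : ℝ) with hs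
  have h1 : ∏ p ∈ s, p ≤ q :=
    (Nat.le_of_dvd (Nat.pos_of_ne_zero hq)
      ((Finset.prod_dvd_prod_of_subset _ _ _ (Finset.filter_subset _ _)).trans
        (Nat.prod_primeFactors_dvd q)))
  have h2 : ∑ _p ∈ s, Real.log x ≤ ∑ p ∈ s, Real.log (p : ℝ) :=
    Finset.sum_le_sum fun p hp => Real.log_le_log hx (Finset.mem_filter.1 hp).2.le
  rw [Finset.sum_const, nsmul_eq_mul] at h2
  refine h2.trans ?_
  rw [← Real.log_prod]
  · apply Real.log_le_log
    · refine Finset.prod_pos fun p hp => ?_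
      exact hx.trans (Finset.mem_filter.1 hp).2
    · rw [← Nat.cast_prod]
      exact Nat.cast_le.2 h1
  · intro p hp
    exact (hx.trans (Finset.mem_filter.1 hp).2).ne'

theorem card_primeFactors_le {q : ℕ} (hq : q ≠ 0) :
    (q.primeFactors.card : ℝ) ≤ 3 * Real.log q := by
  have h := card_primeFactors_gt_mul_log_le hq (x := 3 / 2) (by norm_num)
  rw [Finset.filter_true_of_mem] at h
  · have : (1 / 3 : ℝ) ≤ Real.log (3 / 2) := by
      have := Real.one_sub_inv_le_log_of_pos (show (0 : ℝ) < 3 / 2 by norm_num)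
      norm_num at this ⊢
      linarith
    nlinarith [(q.primeFactors.card).cast_nonneg (α := ℝ)]
  · intro p hp
    have : (2 : ℝ) ≤ p := by exact_mod_cast (Nat.prime_of_mem_primeFactors hp).two_le
    linarith

/-- The primes `p ∤ q` with `log q < p ≤ (log q) ^ K`, on which the resonator is supported. -/
noncomputable def resonatorPrimes (K : ℝ) (q : ℕ) : Finset ℕ :=
  (primesIoc (Real.log q) (Real.log q ^ K)).filter fun p => ¬ p ∣ q

theorem mem_resonatorPrimes {K : ℝ} {q p : ℕ} :
    p ∈ resonatorPrimes K q ↔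
      p.Prime ∧ Real.log q < p ∧ (p : ℝ) ≤ Real.log q ^ K ∧ ¬ p ∣ q := by
  rw [resonatorPrimes, Finset.mem_filter,
    mem_primesIoc (Real.rpow_nonneg (Real.log_natCast_nonneg q) K)]
  tauto

theorem tendsto_log_natCast : Filter.Tendsto (fun q : ℕ => Real.log q) Filter.atTop Filter.atTop :=
  Real.tendsto_log_atTop.comp tendsto_natCast_atTop_atTop

theorem exists_sum_resonatorPrimes_ge {η : ℝ} (hη : 0 < η) :
    ∃ K : ℝ, 1 ≤ K ∧ ∀ᶠ q : ℕ in Filter.atTop,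
      (1 - η) / Real.log (Real.log q) ≤
        ∑ p ∈ resonatorPrimes K q, 1 / ((p : ℝ) * Real.log p) := by
  obtain ⟨K, hK, x₀, hx₀⟩ := exists_sum_primesIoc_ge (half_pos hη)
  refine ⟨K, hK, ?_⟩
  filter_upwards [tendsto_log_natCast.eventually_ge_atTop x₀,
    (Real.tendsto_log_atTop.comp tendsto_log_natCast).eventually_ge_atTop (max 1 (2 / η)),
    Filter.eventually_ge_atTop 3] with q hq1 hq2 hq3
  set x := Real.log q with hx
  have hl : max 1 (2 / η) ≤ Real.log x := hq2
  have hl1 : 1 ≤ Real.log x := (le_max_left _ _).trans hl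
  have hl2 : 2 / η ≤ Real.log x := (le_max_right _ _).trans hl
  have hx0 : 0 < x := by
    apply Real.log_pos; exact_mod_cast (by omega : 1 < q)
  have hcard := card_primeFactors_gt_mul_log_le (q := q) (by omega) hx0
  have h := hx₀ x hq1
  rw [← Finset.sum_filter_add_sum_filter_not (primesIoc x (x ^ K)) (fun p => p ∣ q)] at h
  have hdiv : ∑ p ∈ (primesIoc x (x ^ K)).filter (fun p => p ∣ q), 1 / ((p : ℝ) * Real.log p) ≤
      (η / 2) / Real.log x := by
    calc ∑ p ∈ (primesIoc x (x ^ K)).filter (fun p => p ∣ q), 1 / ((p : ℝ) * Real.log p)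
        ≤ ∑ p ∈ (primesIoc x (x ^ K)).filter (fun p => p ∣ q), 1 / (x * Real.log x) := by
          refine Finset.sum_le_sum fun p hp => ?_
          have hp' := ((mem_primesIoc (by positivity)).1 (Finset.mem_filter.1 hp).1).2.1
          have := Real.log_le_log hx0 hp'.le
          gcongr
      _ ≤ ∑ p ∈ q.primeFactors.filter (fun p : ℕ => x < (p : ℝ)), 1 / (x * Real.log x) := by
          refine Finset.sum_le_sum_of_subset_of_nonneg (fun p hp => ?_)
            (fun _ _ _ => by positivity)
          rw [Finset.mem_filter, mem_primesIoc (by positivity)] at hp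
          rw [Finset.mem_filter, Nat.mem_primeFactors]
          exact ⟨⟨hp.1.1, hp.2, by omega⟩, hp.1.2.1⟩
      _ ≤ (η / 2) / Real.log x := by
          rw [Finset.sum_const, nsmul_eq_mul, mul_one_div,
            div_le_div_iff₀ (by positivity) (by positivity)]
          have : 1 ≤ η / 2 * Real.log x := by
            rw [div_le_iff₀ hη] at hl2; linarith
          calc _ ≤ x := hcard
            _ ≤ (η / 2 * Real.log x) * x := le_mul_of_one_le_left hx0.le this
            _ = _ := by ring
  have : (1 - η) / Real.log x = (1 - η / 2) / Real.log x - (η / 2) / Real.log x := by ring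
  rw [this]
  rw [resonatorPrimes]
  linarith

theorem exists_sum_resonatorPrimes_le {K : ℝ} (hK : 1 ≤ K) :
    ∃ C : ℝ, 0 < C ∧ ∀ᶠ q : ℕ in Filter.atTop,
      ∑ p ∈ resonatorPrimes K q, 1 / ((p : ℝ) * Real.log p) ≤ C / Real.log (Real.log q) := by
  obtain ⟨C, hC, x₀, hx₀⟩ := exists_sum_primesIoc_le hK
  refine ⟨C, hC, ?_⟩
  filter_upwards [tendsto_log_natCast.eventually_ge_atTop x₀] with q hq
  refine le_trans ?_ (hx₀ _ hq)
  exact Finset.sum_le_sum_of_subset_of_nonneg (Finset.filter_subset _ _)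
    fun p _ _ => by have := Real.log_natCast_nonneg p; positivity

/-- A weak form of Chebyshev's lower bound for the number of primes in `(u, z]` that do not divide
`q`. -/
theorem card_primesIoc_not_dvd_ge {q : ℕ} (hq : q ≠ 0) {u z : ℝ} (hz1 : 4 ≤ z) (hu : 0 ≤ u)
    (hzq : z ≤ q) (hlarge : 4 * Real.log q * (u + 3 * Real.log q + 2) ≤ z) :
    z / (4 * Real.log q) ≤ (((primesIoc u z).filter fun p => ¬ p ∣ q).card : ℝ) := by
  have hlq : 0 < Real.log q := Real.log_pos (by linarith)
  have hlz : 0 < Real.log z := Real.log_pos (by linarith)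
  have hpi : z / (2 * Real.log q) - 2 ≤ Nat.primeCounting ⌊z⌋₊ := by
    have h1 := Chebyshev.psi_ge' (show 0 ≤ z by linarith)
    have h2 := Chebyshev.psi_le_primeCounting_mul_log' z
    have h3 : Real.log z ≤ Real.log q := Real.log_le_log (by linarith) hzq
    have h4 : Real.log (z + 2) ≤ Real.log 2 + Real.log z := by
      rw [← Real.log_mul (by norm_num) (by linarith)]
      exact Real.log_le_log (by linarith) (by linarith)
    have h5 : 2 * Real.log 2 ≤ Real.log z := by
      rw [← Real.log_rpow (by norm_num)]
      exact Real.log_le_log (by norm_num) (by norm_num; linarith)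
    have h6 := Real.log_two_gt_d9
    have h7 := Real.log_two_lt_d9
    have h8 : (Nat.primeCounting ⌊z⌋₊ : ℝ) * Real.log z ≤
        Nat.primeCounting ⌊z⌋₊ * Real.log q := by gcongr
    rw [sub_le_iff_le_add, div_le_iff₀ (by positivity)]
    nlinarith
  have hsub : Nat.primesLE ⌊z⌋₊ ⊆ ((primesIoc u z).filter fun p => ¬ p ∣ q) ∪
      (Finset.Icc 1 ⌊u⌋₊ ∪ q.primeFactors) := by
    intro p hp
    rw [Nat.mem_primesLE] at hp
    have h1 : (p : ℝ) ≤ z := (Nat.le_floor_iff (by linarith)).1 hp.1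
    simp only [Finset.mem_union, Finset.mem_filter, mem_primesIoc (by linarith : 0 ≤ z),
      Finset.mem_Icc, Nat.le_floor_iff hu, Nat.mem_primeFactors]
    have := hp.2.one_le
    by_cases h2 : p ∣ q
    · tauto
    · rcases le_or_gt (p : ℝ) u with h | h <;> tauto
  have hcard := (Finset.card_le_card hsub).trans ((Finset.card_union_le _ _).trans
    (Nat.add_le_add_left (Finset.card_union_le _ _) _))
  rw [Nat.primesLE_card_eq_primeCounting, Nat.card_Icc, Nat.add_sub_cancel] at hcard
  have hcard' : (Nat.primeCounting ⌊z⌋₊ : ℝ) ≤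
      ((primesIoc u z).filter fun p => ¬ p ∣ q).card + (⌊u⌋₊ + q.primeFactors.card) := by
    exact_mod_cast hcard
  have hω := card_primeFactors_le hq
  have hfu := Nat.floor_le hu
  have h5 : u + 3 * Real.log q + 2 ≤ z / (4 * Real.log q) := by
    rw [le_div_iff₀ (by positivity)]; linarith
  have h6 : z / (2 * Real.log q) = z / (4 * Real.log q) + z / (4 * Real.log q) := by
    field_simp; ring
  linarith

/-! ### Squarefree products of primes and Rankin's trick -/

theorem sum_sum_ite_eq_sum_sq {α β : Type*} [DecidableEq β] (Ω : Finset α) (φ : α → β)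
    (r : α → ℝ) :
    ∑ x ∈ Ω, ∑ y ∈ Ω, (if φ x = φ y then r x * r y else 0) =
      ∑ c ∈ Ω.image φ, (∑ x ∈ Ω.filter (fun x => φ x = c), r x) ^ 2 := by
  rw [← Finset.sum_fiberwise_of_maps_to (g := φ) (t := Ω.image φ)
    (fun x hx => Finset.mem_image_of_mem φ hx)]
  refine Finset.sum_congr rfl fun c _ => ?_
  rw [sq, Finset.sum_mul]
  refine Finset.sum_congr rfl fun x hx => ?_
  rw [Finset.mul_sum, Finset.sum_filter]
  refine Finset.sum_congr rfl fun y _ => ?_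
  rw [(Finset.mem_filter.1 hx).2]
  simp only [eq_comm]

theorem sum_sq_fiber_le {α β : Type*} [DecidableEq β] (Ω : Finset α) (φ : α → β)
    (r : α → ℝ) (C : Finset β) :
    ∑ c ∈ C, (∑ x ∈ Ω.filter (fun x => φ x = c), r x) ^ 2 ≤
      ∑ x ∈ Ω, ∑ y ∈ Ω, (if φ x = φ y then r x * r y else 0) := by
  rw [sum_sum_ite_eq_sum_sq]
  have h1 : ∑ c ∈ C, (∑ x ∈ Ω.filter (fun x => φ x = c), r x) ^ 2 =
      ∑ c ∈ C ∩ Ω.image φ, (∑ x ∈ Ω.filter (fun x => φ x = c), r x) ^ 2 := by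
    symm
    refine Finset.sum_subset Finset.inter_subset_left fun c hc hc' => ?_
    rw [Finset.filter_eq_empty_iff.2, Finset.sum_empty, sq, zero_mul]
    intro x hx hxc
    exact hc' (Finset.mem_inter.2 ⟨hc, hxc ▸ Finset.mem_image_of_mem φ hx⟩)
  rw [h1]
  exact Finset.sum_le_sum_of_subset_of_nonneg Finset.inter_subset_right
    fun _ _ _ => sq_nonneg _

/-- The positive integers `n ≤ W` coprime to `q`. -/
noncomputable def coprimesUpTo (W : ℝ) (q : ℕ) : Finset ℕ :=
  (Finset.Icc 1 ⌊W⌋₊).filter fun n => n.Coprime q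

/-- The weighted count `∑ r(m₁) r(m₂)` over the solutions of `n₁ m₁ = n₂ m₂` with `m₁, m₂ ∈ M` and
`n₁, n₂ ≤ W` coprime to `q`. -/
noncomputable def collisionSum (W : ℝ) (q : ℕ) (M : Finset ℕ) (r : ℕ → ℝ) : ℝ :=
  ∑ x ∈ coprimesUpTo W q ×ˢ M, ∑ y ∈ coprimesUpTo W q ×ˢ M,
    if x.1 * x.2 = y.1 * y.2 then r x.2 * r y.2 else 0

/-- The squarefree integers `m ≤ y` all of whose prime factors lie in `P`. -/
noncomputable def resonatorSupport (P : Finset ℕ) (y : ℝ) : Finset ℕ :=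
  (P.powerset.filter fun S => ((∏ p ∈ S, p : ℕ) : ℝ) ≤ y).image fun S => ∏ p ∈ S, p

/-- The coefficient `∏ f(p)` over the primes `p ∣ m`. -/
noncomputable def resonatorWeight (f : ℕ → ℝ) (m : ℕ) : ℝ := ∏ p ∈ m.primeFactors, f p

section

variable {P : Finset ℕ}

theorem prod_injOn_powerset (hP : ∀ p ∈ P, p.Prime) :
    Set.InjOn (fun S : Finset ℕ => ∏ p ∈ S, p) (P.powerset : Set (Finset ℕ)) := by
  intro S hS T hT h
  have hS' : ∀ p ∈ S, p.Prime := fun p hp => hP p (Finset.mem_powerset.1 hS hp)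
  have hT' : ∀ p ∈ T, p.Prime := fun p hp => hP p (Finset.mem_powerset.1 hT hp)
  rw [← Nat.primeFactors_prod hS', ← Nat.primeFactors_prod hT']
  exact congrArg _ h

theorem sum_resonatorSupport (hP : ∀ p ∈ P, p.Prime) (y : ℝ) (g : ℕ → ℝ) :
    ∑ m ∈ resonatorSupport P y, g m =
      ∑ S ∈ P.powerset.filter (fun S => ((∏ p ∈ S, p : ℕ) : ℝ) ≤ y), g (∏ p ∈ S, p) := by
  rw [resonatorSupport, Finset.sum_image]
  exact (prod_injOn_powerset hP).mono (by
    intro S hS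
    exact Finset.mem_coe.2 (Finset.mem_filter.1 (Finset.mem_coe.1 hS)).1)

theorem resonatorWeight_prod (hP : ∀ p ∈ P, p.Prime) (f : ℕ → ℝ) {S : Finset ℕ} (hS : S ⊆ P) :
    resonatorWeight f (∏ p ∈ S, p) = ∏ p ∈ S, f p := by
  rw [resonatorWeight, Nat.primeFactors_prod fun p hp => hP p (hS hp)]

theorem sum_resonatorWeight_sq_le (hP : ∀ p ∈ P, p.Prime) (f : ℕ → ℝ) (y : ℝ) :
    ∑ m ∈ resonatorSupport P y, resonatorWeight f m ^ 2 ≤ ∏ p ∈ P, (1 + f p ^ 2) := by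
  rw [sum_resonatorSupport hP, Finset.prod_one_add]
  refine le_trans (le_of_eq (Finset.sum_congr rfl fun S hS => ?_))
    (Finset.sum_le_sum_of_subset_of_nonneg (Finset.filter_subset _ _)
      fun S _ _ => Finset.prod_nonneg fun p _ => sq_nonneg _)
  rw [resonatorWeight_prod hP f (Finset.mem_powerset.1 (Finset.mem_filter.1 hS).1),
    Finset.prod_pow]

theorem sum_powerset_powerset_eq_prod (P : Finset ℕ) (g h : ℕ → ℝ) :
    ∑ S ∈ P.powerset, ∑ T ∈ S.powerset, (∏ p ∈ T, h p) * ∏ p ∈ S \ T, g p =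
      ∏ p ∈ P, (1 + g p + h p) := by
  rw [show (∏ p ∈ P, (1 + g p + h p)) = ∏ p ∈ P, (1 + (h p + g p)) from
    Finset.prod_congr rfl fun p _ => by ring, Finset.prod_one_add]
  exact Finset.sum_congr rfl fun S _ => (Finset.prod_add h g S).symm

theorem sum_powerset_inter_sdiff_eq_prod (P : Finset ℕ) (g h : ℕ → ℝ) :
    ∑ S ∈ P.powerset, ∑ T ∈ P.powerset,
        (∏ p ∈ S ∩ T, g p) * ((∏ p ∈ S \ T, h p) * ∏ p ∈ T \ S, h p) =
      ∏ p ∈ P, (1 + g p + 2 * h p) := by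
  have h1 : ∀ S ∈ P.powerset, ∑ T ∈ P.powerset,
      (∏ p ∈ S ∩ T, g p) * ((∏ p ∈ S \ T, h p) * ∏ p ∈ T \ S, h p) =
      (∏ p ∈ S, (g p + h p)) * ∏ p ∈ P \ S, (h p + 1) := by
    intro S hS
    have hSP := Finset.mem_powerset.1 hS
    have h2 : (∏ p ∈ S, (g p + h p)) * ∏ p ∈ P \ S, (h p + 1) =
        ∏ p ∈ P, ((if p ∈ S then g p else h p) + (if p ∈ S then h p else 1)) := by
      rw [← Finset.prod_sdiff hSP, mul_comm]
      congr 1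
      · exact Finset.prod_congr rfl fun p hp => by simp [(Finset.mem_sdiff.1 hp).2]
      · exact Finset.prod_congr rfl fun p hp => by simp [hp]
    rw [h2, Finset.prod_add]
    refine Finset.sum_congr rfl fun T hT => ?_
    have hTP := Finset.mem_powerset.1 hT
    rw [Finset.prod_ite, Finset.prod_ite, Finset.prod_const_one, mul_one]
    have e1 : T.filter (fun p => p ∈ S) = S ∩ T := by ext p; simp [and_comm]
    have e2 : T.filter (fun p => p ∉ S) = T \ S := by ext p; simp
    have e3 : (P \ T).filter (fun p => p ∈ S) = S \ T := by
      ext p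
      simp only [Finset.mem_filter, Finset.mem_sdiff]
      exact ⟨fun h => ⟨h.2, h.1.2⟩, fun h => ⟨⟨hSP h.1, h.2⟩, h.1⟩⟩
    rw [e1, e2, e3]
    ring
  rw [Finset.sum_congr rfl h1, ← Finset.prod_add]
  exact Finset.prod_congr rfl fun p _ => by ring

/-- Rankin's trick. -/
theorem one_le_rpow_neg_mul_rpow {y t α : ℝ} (hy : 0 < y) (ht : y ≤ t) (hα : 0 ≤ α) :
    1 ≤ y ^ (-α) * t ^ α := by
  rw [Real.rpow_neg hy.le, inv_mul_eq_div, le_div_iff₀ (by positivity), one_mul]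
  exact Real.rpow_le_rpow hy.le ht hα

theorem prod_natCast_rpow (S : Finset ℕ) (α : ℝ) :
    ((∏ p ∈ S, p : ℕ) : ℝ) ^ α = ∏ p ∈ S, (p : ℝ) ^ α := by
  rw [Nat.cast_prod, Real.finsetProd_rpow _ _ fun p _ => Nat.cast_nonneg p]

/-- Removing from the expansion of `∏ (1 + g(p) + h(p))` the terms with `∏_{p ∈ S} p > y` or
`∏_{p ∈ T} p > D` costs little, by Rankin's trick. -/
theorem prod_sub_tails_le (P : Finset ℕ) {g h : ℕ → ℝ} (hg : ∀ p, 0 ≤ g p) (hh : ∀ p, 0 ≤ h p)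
    {y D α : ℝ} (hy : 0 < y) (hD : 0 < D) (hα : 0 ≤ α) :
    ∏ p ∈ P, (1 + g p + h p) - y ^ (-α) * ∏ p ∈ P, (1 + g p * (p : ℝ) ^ α + h p * (p : ℝ) ^ α)
        - D ^ (-α) * ∏ p ∈ P, (1 + g p + h p * (p : ℝ) ^ α) ≤
      ∑ S ∈ P.powerset.filter (fun S => ((∏ p ∈ S, p : ℕ) : ℝ) ≤ y),
        ∑ T ∈ S.powerset.filter (fun T => ((∏ p ∈ T, p : ℕ) : ℝ) ≤ D),
          (∏ p ∈ T, h p) * ∏ p ∈ S \ T, g p := by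
  rw [← sum_powerset_powerset_eq_prod, ← sum_powerset_powerset_eq_prod,
    ← sum_powerset_powerset_eq_prod, Finset.mul_sum, Finset.mul_sum, Finset.sum_filter,
    ← Finset.sum_sub_distrib, ← Finset.sum_sub_distrib]
  refine Finset.sum_le_sum fun S _ => ?_
  have hterm : ∀ (T : Finset ℕ), 0 ≤ (∏ p ∈ T, h p) * ∏ p ∈ S \ T, g p := fun T =>
    mul_nonneg (Finset.prod_nonneg fun p _ => hh p) (Finset.prod_nonneg fun p _ => hg p)
  have hpw : ∀ (T : Finset ℕ), 0 ≤ ∏ p ∈ T, (p : ℝ) ^ α := fun T =>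
    Finset.prod_nonneg fun p _ => by positivity
  have ha : ∀ T, D ^ (-α) * ((∏ p ∈ T, h p * (p : ℝ) ^ α) * ∏ p ∈ S \ T, g p) =
      D ^ (-α) * ((∏ p ∈ T, p : ℕ) : ℝ) ^ α * ((∏ p ∈ T, h p) * ∏ p ∈ S \ T, g p) := by
    intro T
    rw [Finset.prod_mul_distrib, prod_natCast_rpow]; ring
  have hb : ∀ T ∈ S.powerset, y ^ (-α) * ((∏ p ∈ T, h p * (p : ℝ) ^ α) *
      ∏ p ∈ S \ T, (g p * (p : ℝ) ^ α)) =
      y ^ (-α) * ((∏ p ∈ S, p : ℕ) : ℝ) ^ α * ((∏ p ∈ T, h p) * ∏ p ∈ S \ T, g p) := by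
    intro T hT
    rw [Finset.prod_mul_distrib, Finset.prod_mul_distrib, prod_natCast_rpow,
      ← Finset.prod_sdiff (Finset.mem_powerset.1 hT)]; ring
  have hD0 : 0 ≤ D ^ (-α) := by positivity
  have hy0 : 0 ≤ y ^ (-α) := by positivity
  rw [Finset.mul_sum, Finset.mul_sum, Finset.sum_congr rfl hb, Finset.sum_congr rfl fun T _ => ha T,
    ← Finset.sum_sub_distrib, ← Finset.sum_sub_distrib]
  split_ifs with hS
  · rw [Finset.sum_filter]
    refine Finset.sum_le_sum fun T _ => ?_
    have h1 : 0 ≤ y ^ (-α) * ((∏ p ∈ S, p : ℕ) : ℝ) ^ α *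
        ((∏ p ∈ T, h p) * ∏ p ∈ S \ T, g p) := mul_nonneg (by positivity) (hterm T)
    split_ifs with hT
    · have h2 : 0 ≤ D ^ (-α) * ((∏ p ∈ T, p : ℕ) : ℝ) ^ α *
        ((∏ p ∈ T, h p) * ∏ p ∈ S \ T, g p) := mul_nonneg (by positivity) (hterm T)
      linarith
    · have h2 := one_le_rpow_neg_mul_rpow hD (not_le.1 hT).le hα
      have := mul_le_mul_of_nonneg_right h2 (hterm T)
      linarith
  · refine Finset.sum_nonpos fun T _ => ?_
    have h1 := one_le_rpow_neg_mul_rpow hy (not_le.1 hS).le hα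
    have := mul_le_mul_of_nonneg_right h1 (hterm T)
    have h2 : 0 ≤ D ^ (-α) * ((∏ p ∈ T, p : ℕ) : ℝ) ^ α *
        ((∏ p ∈ T, h p) * ∏ p ∈ S \ T, g p) := mul_nonneg (by positivity) (hterm T)
    linarith

end

/-! ### The collision sum of a multiplicative resonator -/

section

variable {P : Finset ℕ}

theorem mem_coprimesUpTo {W : ℝ} (hW : 0 ≤ W) {q n : ℕ} :
    n ∈ coprimesUpTo W q ↔ 1 ≤ n ∧ (n : ℝ) ≤ W ∧ n.Coprime q := by
  rw [coprimesUpTo, Finset.mem_filter, Finset.mem_Icc, Nat.le_floor_iff hW, and_assoc]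

theorem prod_pos_of_primes {S : Finset ℕ} (hS : ∀ p ∈ S, p.Prime) : 0 < ∏ p ∈ S, p :=
  Finset.prod_pos fun p hp => (hS p hp).pos

/-- If no element of the set of primes `𝒦` lies in `P`, then products of an element of `𝒦` with a
squarefree product of primes of `P` factor uniquely. -/
theorem mul_prod_injOn (hP : ∀ p ∈ P, p.Prime) {𝒦 : Finset ℕ} (h𝒦 : ∀ k ∈ 𝒦, k.Prime ∧ k ∉ P) :
    Set.InjOn (fun x : ℕ × Finset ℕ => x.1 * ∏ p ∈ x.2, p)
      ((𝒦 ×ˢ P.powerset : Finset (ℕ × Finset ℕ)) : Set (ℕ × Finset ℕ)) := by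
  rintro ⟨k, S⟩ hx ⟨l, T⟩ hy h
  simp only [Finset.coe_product, Set.mem_prod, Finset.mem_coe, Finset.mem_powerset] at hx hy
  simp only at h
  have hk := h𝒦 k hx.1
  have hT : ∀ p ∈ T, p.Prime := fun p hp => hP p (hy.2 hp)
  have hkl : k = l := by
    have hd : k ∣ l * ∏ p ∈ T, p := h ▸ dvd_mul_right k _
    rcases (Nat.Prime.dvd_mul hk.1).1 hd with h1 | h1
    · exact (Nat.prime_dvd_prime_iff_eq hk.1 (h𝒦 l hy.1).1).1 h1
    · have := (Nat.mem_primeFactors_of_ne_zero (prod_pos_of_primes hT).ne').2 ⟨hk.1, h1⟩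
      rw [Nat.primeFactors_prod hT] at this
      exact absurd (hy.2 this) hk.2
  subst hkl
  have h2 := Nat.eq_of_mul_eq_mul_left hk.1.pos h
  rw [prod_injOn_powerset hP (Finset.mem_coe.2 (Finset.mem_powerset.2 hx.2))
    (Finset.mem_coe.2 (Finset.mem_powerset.2 hy.2)) h2]

/-- A lower bound for the collision sum: Cauchy–Schwarz against the coefficients `r(m)` placed at the
integers `k m`, where `k` runs over a set `𝒦` of auxiliary primes. For `T ⊆ S` the integer
`k ∏_{p ∈ S} p` is the product of `n = k ∏_{p ∈ T} p` and `m = ∏_{p ∈ S \ T} p`. -/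
theorem card_mul_sq_le_collisionSum (hP : ∀ p ∈ P, p.Prime) {q : ℕ} (hPq : ∀ p ∈ P, ¬ p ∣ q)
    {f : ℕ → ℝ} (hf : ∀ p, 0 ≤ f p) {W y : ℝ} (hW : 0 ≤ W) {𝒦 : Finset ℕ}
    (h𝒦 : ∀ k ∈ 𝒦, k.Prime ∧ k ∉ P ∧ ¬ k ∣ q) {𝒯 : Finset (Finset ℕ)}
    (h𝒯 : ∀ k ∈ 𝒦, ∀ T ∈ 𝒯, ((k * ∏ p ∈ T, p : ℕ) : ℝ) ≤ W) :
    (𝒦.card : ℝ) * (∑ S ∈ P.powerset.filter (fun S => ((∏ p ∈ S, p : ℕ) : ℝ) ≤ y),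
        (∏ p ∈ S, f p) * ∑ T ∈ S.powerset.filter (fun T => T ∈ 𝒯), ∏ p ∈ S \ T, f p) ^ 2 ≤
      (∑ m ∈ resonatorSupport P y, resonatorWeight f m ^ 2) *
        collisionSum W q (resonatorSupport P y) (resonatorWeight f) := by
  set 𝒮 := P.powerset.filter (fun S => ((∏ p ∈ S, p : ℕ) : ℝ) ≤ y) with h𝒮
  set M := resonatorSupport P y with hM
  set r := resonatorWeight f with hr
  set B : Finset ℕ → ℝ := fun S => ∑ T ∈ S.powerset.filter (fun T => T ∈ 𝒯), ∏ p ∈ S \ T, f p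
  have hSP : ∀ S ∈ 𝒮, S ⊆ P := fun S hS => Finset.mem_powerset.1 (Finset.mem_filter.1 hS).1
  have hr0 : ∀ m, 0 ≤ r m := fun m => Finset.prod_nonneg fun p _ => hf p
  have hB0 : ∀ S, 0 ≤ B S := fun S =>
    Finset.sum_nonneg fun T _ => Finset.prod_nonneg fun p _ => hf p
  set A : ℕ → ℝ := fun c =>
    ∑ x ∈ (coprimesUpTo W q ×ˢ M).filter (fun x => x.1 * x.2 = c), r x.2 with hA
  have hAB : ∀ k ∈ 𝒦, ∀ S ∈ 𝒮, B S ≤ A (k * ∏ p ∈ S, p) := by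
    intro k hk S hS
    have hS' := hSP S hS
    have hinj : Set.InjOn (fun T : Finset ℕ => (k * ∏ p ∈ T, p, ∏ p ∈ S \ T, p))
        (S.powerset.filter (fun T => T ∈ 𝒯) : Finset (Finset ℕ)) := by
      intro T hT T' hT' h
      have h2 : ∏ p ∈ T, p = ∏ p ∈ T', p :=
        Nat.eq_of_mul_eq_mul_left (h𝒦 k hk).1.pos (Prod.ext_iff.1 h).1
      have hTS := Finset.mem_powerset.1 (Finset.mem_filter.1 (Finset.mem_coe.1 hT)).1
      have hTS' := Finset.mem_powerset.1 (Finset.mem_filter.1 (Finset.mem_coe.1 hT')).1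
      exact prod_injOn_powerset hP (Finset.mem_coe.2 (Finset.mem_powerset.2 (hTS.trans hS')))
        (Finset.mem_coe.2 (Finset.mem_powerset.2 (hTS'.trans hS'))) h2
    have h1 : B S = ∑ x ∈ (S.powerset.filter (fun T => T ∈ 𝒯)).image
        (fun T : Finset ℕ => (k * ∏ p ∈ T, p, ∏ p ∈ S \ T, p)), r x.2 := by
      rw [Finset.sum_image hinj]
      refine Finset.sum_congr rfl fun T _ => ?_
      rw [hr, resonatorWeight_prod hP f (Finset.sdiff_subset.trans hS')]
    rw [h1]
    refine Finset.sum_le_sum_of_subset_of_nonneg (fun x hx => ?_) fun x _ _ => hr0 _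
    obtain ⟨T, hT, rfl⟩ := Finset.mem_image.1 hx
    rw [Finset.mem_filter, Finset.mem_powerset] at hT
    have hTP := hT.1.trans hS'
    rw [Finset.mem_filter, Finset.mem_product, mem_coprimesUpTo hW]
    refine ⟨⟨⟨?_, h𝒯 k hk T hT.2, ?_⟩, ?_⟩, ?_⟩
    · exact Nat.mul_pos (h𝒦 k hk).1.pos (prod_pos_of_primes fun p hp => hP p (hTP hp))
    · refine Nat.Coprime.mul_left ?_ (Nat.Coprime.prod_left fun p hp => ?_)
      · exact (Nat.Prime.coprime_iff_not_dvd (h𝒦 k hk).1).2 (h𝒦 k hk).2.2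
      · exact (Nat.Prime.coprime_iff_not_dvd (hP p (hTP hp))).2 (hPq p (hTP hp))
    · rw [hM, resonatorSupport]
      refine Finset.mem_image_of_mem _ ?_
      rw [Finset.mem_filter, Finset.mem_powerset]
      refine ⟨Finset.sdiff_subset.trans hS', le_trans ?_ (Finset.mem_filter.1 hS).2⟩
      exact_mod_cast Nat.le_of_dvd (prod_pos_of_primes fun p hp => hP p (hS' hp))
        (Finset.prod_dvd_prod_of_subset _ _ _ Finset.sdiff_subset)
    · simp only
      rw [← Finset.prod_sdiff hT.1]; ring
  have hcol : (𝒦.card : ℝ) * ∑ S ∈ 𝒮, B S ^ 2 ≤ collisionSum W q M r := by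
    have h1 := sum_sq_fiber_le (coprimesUpTo W q ×ˢ M) (fun x => x.1 * x.2) (fun x => r x.2)
      ((𝒦 ×ˢ 𝒮).image fun x : ℕ × Finset ℕ => x.1 * ∏ p ∈ x.2, p)
    rw [Finset.sum_image ((mul_prod_injOn hP fun k hk => ⟨(h𝒦 k hk).1, (h𝒦 k hk).2.1⟩).mono ?_),
      Finset.sum_product] at h1
    · refine le_trans ?_ h1
      rw [← nsmul_eq_mul, ← Finset.sum_const]
      refine Finset.sum_le_sum fun k hk => Finset.sum_le_sum fun S hS => ?_
      exact pow_le_pow_left₀ (hB0 S) (hAB k hk S hS) 2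
    · exact Finset.coe_subset.2
        (Finset.product_subset_product_right (Finset.filter_subset _ _))
  have hρ : ∑ m ∈ M, r m ^ 2 = ∑ S ∈ 𝒮, (∏ p ∈ S, f p) ^ 2 := by
    rw [hM, sum_resonatorSupport hP]
    exact Finset.sum_congr rfl fun S hS => by rw [hr, resonatorWeight_prod hP f (hSP S hS)]
  rw [hρ]
  have hcs := Finset.sum_mul_sq_le_sq_mul_sq 𝒮 (fun S => ∏ p ∈ S, f p) B
  have h0 : 0 ≤ ∑ S ∈ 𝒮, (∏ p ∈ S, f p) ^ 2 := Finset.sum_nonneg fun S _ => sq_nonneg _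
  calc (𝒦.card : ℝ) * (∑ S ∈ 𝒮, (∏ p ∈ S, f p) * B S) ^ 2
      ≤ 𝒦.card * ((∑ S ∈ 𝒮, (∏ p ∈ S, f p) ^ 2) * ∑ S ∈ 𝒮, B S ^ 2) := by gcongr
    _ = (∑ S ∈ 𝒮, (∏ p ∈ S, f p) ^ 2) * (𝒦.card * ∑ S ∈ 𝒮, B S ^ 2) := by ring
    _ ≤ _ := by gcongr

/-- The collision sum is bounded below by sorting the subsets `T` into dyadic classes according to
the size of `∏_{p ∈ T} p` and keeping the most favourable class. -/
theorem sq_le_collisionSum (hP : ∀ p ∈ P, p.Prime) {q : ℕ} (hPq : ∀ p ∈ P, ¬ p ∣ q)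
    {f : ℕ → ℝ} (hf : ∀ p, 0 ≤ f p) {W y D κ : ℝ} (hW : 0 ≤ W) {J : ℕ} (hJ : 0 < J)
    (hDJ : D < 2 ^ J)
    (h𝒦 : ∀ j < J, ∃ 𝒦 : Finset ℕ, κ * (W / 2 ^ (j + 1)) ≤ (𝒦.card : ℝ) ∧
      ∀ k ∈ 𝒦, k.Prime ∧ k ∉ P ∧ ¬ k ∣ q ∧ (k : ℝ) * 2 ^ (j + 1) ≤ W)
    (hZ0 : 0 ≤ ∑ S ∈ P.powerset.filter (fun S => ((∏ p ∈ S, p : ℕ) : ℝ) ≤ y),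
      ∑ T ∈ S.powerset.filter (fun T => ((∏ p ∈ T, p : ℕ) : ℝ) ≤ D),
        (∏ p ∈ T, f p / √(p : ℝ)) * ∏ p ∈ S \ T, f p ^ 2) :
    κ * W * (∑ S ∈ P.powerset.filter (fun S => ((∏ p ∈ S, p : ℕ) : ℝ) ≤ y),
      ∑ T ∈ S.powerset.filter (fun T => ((∏ p ∈ T, p : ℕ) : ℝ) ≤ D),
        (∏ p ∈ T, f p / √(p : ℝ)) * ∏ p ∈ S \ T, f p ^ 2) ^ 2 ≤
      2 * (J : ℝ) ^ 2 * ((∑ m ∈ resonatorSupport P y, resonatorWeight f m ^ 2) *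
        collisionSum W q (resonatorSupport P y) (resonatorWeight f)) := by
  set 𝒮 := P.powerset.filter (fun S => ((∏ p ∈ S, p : ℕ) : ℝ) ≤ y) with h𝒮
  set 𝒯 : ℕ → Finset (Finset ℕ) := fun j => P.powerset.filter fun T =>
    ((∏ p ∈ T, p : ℕ) : ℝ) ≤ D ∧ Nat.log 2 (∏ p ∈ T, p) = j with h𝒯
  set t : Finset ℕ → Finset ℕ → ℝ := fun S T =>
    (∏ p ∈ T, f p / √(p : ℝ)) * ∏ p ∈ S \ T, f p ^ 2 with ht
  set Z := ∑ S ∈ 𝒮, ∑ T ∈ S.powerset.filter (fun T => ((∏ p ∈ T, p : ℕ) : ℝ) ≤ D), t S T with hZ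
  have hSP : ∀ S ∈ 𝒮, S ⊆ P := fun S hS => Finset.mem_powerset.1 (Finset.mem_filter.1 hS).1
  have hsplit : Z = ∑ j ∈ Finset.range J,
      ∑ S ∈ 𝒮, ∑ T ∈ S.powerset.filter (fun T => T ∈ 𝒯 j), t S T := by
    rw [Finset.sum_comm, hZ]
    refine Finset.sum_congr rfl fun S hS => ?_
    rw [← Finset.sum_fiberwise_of_maps_to (g := fun T : Finset ℕ => Nat.log 2 (∏ p ∈ T, p))
      (t := Finset.range J)]
    · refine Finset.sum_congr rfl fun j _ => Finset.sum_congr ?_ fun _ _ => rfl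
      ext T
      simp only [Finset.mem_filter, Finset.mem_powerset, h𝒯]
      constructor
      · rintro ⟨⟨h1, h2⟩, h3⟩
        exact ⟨h1, h1.trans (hSP S hS), h2, h3⟩
      · rintro ⟨h1, -, h2, h3⟩
        exact ⟨⟨h1, h2⟩, h3⟩
    · intro T hT
      rw [Finset.mem_filter, Finset.mem_powerset] at hT
      rw [Finset.mem_range]
      have hpos : 0 < ∏ p ∈ T, p := prod_pos_of_primes fun p hp => hP p (hSP S hS (hT.1 hp))
      have : ((∏ p ∈ T, p : ℕ) : ℝ) < 2 ^ J := hT.2.trans_lt hDJ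
      exact Nat.log_lt_of_lt_pow hpos.ne' (by exact_mod_cast this)
  obtain ⟨j, hj, hjZ⟩ : ∃ j ∈ Finset.range J,
      Z / J ≤ ∑ S ∈ 𝒮, ∑ T ∈ S.powerset.filter (fun T => T ∈ 𝒯 j), t S T := by
    refine Finset.exists_le_of_sum_le (Finset.nonempty_range_iff.2 hJ.ne') ?_
    rw [← hsplit, Finset.sum_const, Finset.card_range, nsmul_eq_mul]
    have : (J : ℝ) ≠ 0 := by exact_mod_cast hJ.ne'
    rw [mul_div_cancel₀ _ this]
  obtain ⟨𝒦, hcard, hk⟩ := h𝒦 j (Finset.mem_range.1 hj)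
  set Q := ∑ S ∈ 𝒮, (∏ p ∈ S, f p) * ∑ T ∈ S.powerset.filter (fun T => T ∈ 𝒯 j),
    ∏ p ∈ S \ T, f p with hQ
  have hmain := card_mul_sq_le_collisionSum (y := y) hP hPq hf hW (𝒦 := 𝒦) (𝒯 := 𝒯 j)
    (fun k h => ⟨(hk k h).1, (hk k h).2.1, (hk k h).2.2.1⟩) (by
      intro k h T hT
      rw [h𝒯, Finset.mem_filter] at hT
      refine le_trans ?_ (hk k h).2.2.2
      rw [Nat.cast_mul]
      gcongr
      have := Nat.lt_pow_succ_log_self (b := 2) (by norm_num) (∏ p ∈ T, p)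
      rw [hT.2.2] at this
      exact_mod_cast this.le)
  have hZQ : Z / J * √(2 ^ j) ≤ Q := by
    refine (mul_le_mul_of_nonneg_right hjZ (Real.sqrt_nonneg _)).trans ?_
    rw [Finset.sum_mul, hQ]
    refine Finset.sum_le_sum fun S hS => ?_
    rw [Finset.sum_mul, Finset.mul_sum]
    refine Finset.sum_le_sum fun T hT => ?_
    rw [Finset.mem_filter, Finset.mem_powerset, h𝒯, Finset.mem_filter] at hT
    have hpos : 0 < ∏ p ∈ T, p := prod_pos_of_primes fun p hp => hP p (hSP S hS (hT.1 hp))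
    have h1 : (2 : ℝ) ^ j ≤ ((∏ p ∈ T, p : ℕ) : ℝ) := by
      have := Nat.pow_log_le_self 2 hpos.ne'
      rw [hT.2.2.2] at this
      exact_mod_cast this
    have h2 : t S T * √((∏ p ∈ T, p : ℕ) : ℝ) =
        (∏ p ∈ S, f p) * ∏ p ∈ S \ T, f p := by
      have h3 : √((∏ p ∈ T, p : ℕ) : ℝ) = ∏ p ∈ T, √(p : ℝ) := by
        simp only [Real.sqrt_eq_rpow]
        exact prod_natCast_rpow T _
      have h4 : ∏ p ∈ T, √(p : ℝ) ≠ 0 := by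
        rw [← h3]
        exact (Real.sqrt_pos.2 (by exact_mod_cast hpos)).ne'
      rw [ht, h3, ← Finset.prod_sdiff hT.1]
      simp only [Finset.prod_div_distrib, Finset.prod_pow]
      field_simp
    rw [← h2]
    have h5 : 0 ≤ t S T := mul_nonneg
      (Finset.prod_nonneg fun p _ => div_nonneg (hf p) (Real.sqrt_nonneg _))
      (Finset.prod_nonneg fun p _ => sq_nonneg _)
    gcongr
  have hJ0 : (0 : ℝ) < J := by exact_mod_cast hJ
  have hsq : (Z / J) ^ 2 * 2 ^ j ≤ Q ^ 2 := by
    have := pow_le_pow_left₀ (by positivity) hZQ 2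
    rwa [mul_pow, Real.sq_sqrt (by positivity)] at this
  have hfin : κ * (W / 2 ^ (j + 1)) * ((Z / J) ^ 2 * 2 ^ j) ≤ 𝒦.card * Q ^ 2 := by gcongr
  have hexp : κ * (W / 2 ^ (j + 1)) * ((Z / J) ^ 2 * 2 ^ j) = κ * W * Z ^ 2 / (2 * J ^ 2) := by
    field_simp
    ring
  rw [hexp] at hfin
  have := hfin.trans hmain
  rw [div_le_iff₀ (by positivity)] at this
  linarith

/-- Rankin's bound for the pairs `m₁, m₂` whose quotients by their greatest common divisor are not
both at most `W`. -/
theorem sum_large_quotient_le (hP : ∀ p ∈ P, p.Prime) {f : ℕ → ℝ} (hf : ∀ p, 0 ≤ f p) {y W α : ℝ}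
    (hW : 0 < W) (hα : 0 ≤ α) :
    ∑ m ∈ resonatorSupport P y, ∑ n ∈ resonatorSupport P y,
      (if W < ((max m n / m.gcd n : ℕ) : ℝ) then
        resonatorWeight f m * resonatorWeight f n / ((max m n / m.gcd n : ℕ) : ℝ) else 0) ≤
      W ^ (-α) * ∏ p ∈ P, (1 + f p ^ 2 + 2 * (f p / √(p : ℝ) * (p : ℝ) ^ α)) := by
  set F : ℕ → ℕ → ℝ := fun m n => if W < ((max m n / m.gcd n : ℕ) : ℝ) then
        resonatorWeight f m * resonatorWeight f n / ((max m n / m.gcd n : ℕ) : ℝ) else 0 with hF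
  have hw : ∀ m, 0 ≤ resonatorWeight f m := fun m => Finset.prod_nonneg fun p _ => hf p
  have hF0 : ∀ m n, 0 ≤ F m n := by
    intro m n
    simp only [hF]
    split_ifs
    · have := hw m
      have := hw n
      positivity
    · exact le_rfl
  have key : ∀ S ∈ P.powerset, ∀ T ∈ P.powerset, F (∏ p ∈ S, p) (∏ p ∈ T, p) ≤
      W ^ (-α) * ((∏ p ∈ S ∩ T, f p ^ 2) * ((∏ p ∈ S \ T, (f p / √(p : ℝ) * (p : ℝ) ^ α)) *
        ∏ p ∈ T \ S, (f p / √(p : ℝ) * (p : ℝ) ^ α))) := by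
    intro S hS T hT
    rw [Finset.mem_powerset] at hS hT
    set G := ∏ p ∈ S ∩ T, p with hG
    set A := ∏ p ∈ S \ T, p with hA
    set B := ∏ p ∈ T \ S, p with hB
    have hSf : ∀ g : ℕ → ℝ, ∏ p ∈ S, g p = (∏ p ∈ S ∩ T, g p) * ∏ p ∈ S \ T, g p := by
      intro g
      exact (Finset.prod_inter_mul_prod_sdiff S T g).symm
    have hTf : ∀ g : ℕ → ℝ, ∏ p ∈ T, g p = (∏ p ∈ S ∩ T, g p) * ∏ p ∈ T \ S, g p := by
      intro g
      rw [Finset.inter_comm]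
      exact (Finset.prod_inter_mul_prod_sdiff T S g).symm
    have hS2 : ∏ p ∈ S, p = G * A := (Finset.prod_inter_mul_prod_sdiff S T _).symm
    have hT2 : ∏ p ∈ T, p = G * B := by
      rw [hG, Finset.inter_comm]
      exact (Finset.prod_inter_mul_prod_sdiff T S _).symm
    have hA0 : 0 < A := prod_pos_of_primes fun p hp => hP p (hS (Finset.sdiff_subset hp))
    have hB0 : 0 < B := prod_pos_of_primes fun p hp => hP p (hT (Finset.sdiff_subset hp))
    have hG0 : 0 < G := prod_pos_of_primes fun p hp => hP p (hS (Finset.inter_subset_left hp))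
    have hcop : A.Coprime B := by
      refine Nat.Coprime.prod_left fun p hp => Nat.Coprime.prod_right fun p' hp' => ?_
      rw [Finset.mem_sdiff] at hp hp'
      rw [Nat.coprime_primes (hP p (hS hp.1)) (hP p' (hT hp'.1))]
      rintro rfl
      exact hp.2 hp'.1
    have hquot : max (∏ p ∈ S, p) (∏ p ∈ T, p) / (∏ p ∈ S, p).gcd (∏ p ∈ T, p) = max A B := by
      rw [hS2, hT2, Nat.gcd_mul_left, hcop.gcd_eq_one, mul_one, Nat.mul_max_mul_left,
        Nat.mul_div_cancel_left _ hG0]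
    have hfd : ∀ U : Finset ℕ, ∏ p ∈ U, (f p / √(p : ℝ) * (p : ℝ) ^ α) =
        (∏ p ∈ U, f p) / √((∏ p ∈ U, p : ℕ) : ℝ) * ((∏ p ∈ U, p : ℕ) : ℝ) ^ α := by
      intro U
      rw [Finset.prod_mul_distrib, Finset.prod_div_distrib, prod_natCast_rpow]
      simp only [Real.sqrt_eq_rpow]
      rw [prod_natCast_rpow]
    simp only [hF]
    rw [hquot, hfd, hfd, resonatorWeight_prod hP f hS, resonatorWeight_prod hP f hT, hSf f, hTf f,
      ← hA, ← hB, Finset.prod_pow]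
    have hA1 : (1 : ℝ) ≤ A := by exact_mod_cast hA0
    have hB1 : (1 : ℝ) ≤ B := by exact_mod_cast hB0
    set a := ∏ p ∈ S \ T, f p
    set b := ∏ p ∈ T \ S, f p
    set g := ∏ p ∈ S ∩ T, f p
    have ha : 0 ≤ a := Finset.prod_nonneg fun p _ => hf p
    have hb : 0 ≤ b := Finset.prod_nonneg fun p _ => hf p
    have hg : 0 ≤ g := Finset.prod_nonneg fun p _ => hf p
    split_ifs with hlt
    · set X : ℝ := ((max A B : ℕ) : ℝ) with hX
      have hAX : (A : ℝ) ≤ X := by rw [hX]; exact_mod_cast le_max_left A B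
      have hBX : (B : ℝ) ≤ X := by rw [hX]; exact_mod_cast le_max_right A B
      have hX0 : 0 < X := by linarith
      have hXAB : X ≤ A * B := by
        rw [hX, Nat.cast_max]
        exact max_le (le_mul_of_one_le_right (by linarith) hB1)
          (le_mul_of_one_le_left (by linarith) hA1)
      have h1 := one_le_rpow_neg_mul_rpow hW hlt.le hα
      have h2 : X ^ α ≤ (A : ℝ) ^ α * (B : ℝ) ^ α := by
        rw [← Real.mul_rpow (by positivity) (by positivity)]
        exact Real.rpow_le_rpow hX0.le hXAB hα
      have h3 : √(A : ℝ) * √(B : ℝ) ≤ X := by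
        rw [← Real.sqrt_mul (by positivity)]
        apply Real.sqrt_le_iff.2 ⟨hX0.le, ?_⟩
        rw [sq]; gcongr
      have h4 : X⁻¹ ≤ (√(A : ℝ) * √(B : ℝ))⁻¹ := by
        have := Real.sqrt_pos.2 (show (0 : ℝ) < A by linarith)
        have := Real.sqrt_pos.2 (show (0 : ℝ) < B by linarith)
        gcongr
      calc g * a * (g * b) / X = g ^ 2 * a * b * X⁻¹ * 1 := by ring
        _ ≤ g ^ 2 * a * b * (√(A : ℝ) * √(B : ℝ))⁻¹ * (W ^ (-α) * ((A : ℝ) ^ α * (B : ℝ) ^ α)) := by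
          have : 1 ≤ W ^ (-α) * ((A : ℝ) ^ α * (B : ℝ) ^ α) := h1.trans (by gcongr)
          gcongr
        _ = _ := by ring
    · positivity
  rw [sum_resonatorSupport hP]
  simp only [sum_resonatorSupport hP]
  rw [← sum_powerset_inter_sdiff_eq_prod, Finset.mul_sum]
  refine le_trans (Finset.sum_le_sum_of_subset_of_nonneg (Finset.filter_subset _ _)
    fun S _ _ => Finset.sum_nonneg fun T _ => hF0 _ _) (Finset.sum_le_sum fun S hS => ?_)
  rw [Finset.mul_sum]
  exact le_trans (Finset.sum_le_sum_of_subset_of_nonneg (Finset.filter_subset _ _)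
    fun T _ _ => hF0 _ _) (Finset.sum_le_sum fun T hT => key S hS T hT)

end

/-! ### The resonator with explicit parameters -/

/-- The multiplicative weight `L / (√p log p)` of the resonator at a prime `p`. -/
noncomputable def primeWeight (L : ℝ) (p : ℕ) : ℝ := L / (√(p : ℝ) * Real.log p)

theorem primeWeight_nonneg {L : ℝ} (hL : 0 ≤ L) (p : ℕ) : 0 ≤ primeWeight L p := by
  have := Real.log_natCast_nonneg p
  rw [primeWeight]; positivity

theorem primeWeight_sq (L : ℝ) (p : ℕ) :
    primeWeight L p ^ 2 = L ^ 2 * (1 / (p * Real.log p)) / Real.log p := by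
  rw [primeWeight, div_pow, mul_pow, Real.sq_sqrt (Nat.cast_nonneg p)]
  rw [mul_one_div, div_div]; ring

theorem primeWeight_div_sqrt (L : ℝ) (p : ℕ) :
    primeWeight L p / √(p : ℝ) = L * (1 / (p * Real.log p)) := by
  rw [primeWeight, div_div, mul_right_comm, Real.mul_self_sqrt (Nat.cast_nonneg p), mul_one_div]

theorem one_add_mul_exp_le {η g h : ℝ} (hη0 : 0 ≤ η) (hη : η ≤ 1) (hg0 : 0 ≤ g) (hh0 : 0 ≤ h)
    (hg : g ≤ η / 2) (hh : h ≤ η / 2) : (1 + g) * Real.exp ((1 - η) * h) ≤ 1 + g + h := by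
  have hu : (1 - η) * h < 1 := by nlinarith
  have h1 : Real.exp ((1 - η) * h) ≤ 1 / (1 - (1 - η) * h) :=
    Real.exp_bound_div_one_sub_of_interval (by nlinarith) hu
  calc (1 + g) * Real.exp ((1 - η) * h) ≤ (1 + g) * (1 / (1 - (1 - η) * h)) := by gcongr
    _ ≤ 1 + g + h := by
      rw [mul_one_div, div_le_iff₀ (by linarith)]
      have : 0 ≤ h * (1 - (1 - η) * (1 + g + h)) := by
        apply mul_nonneg hh0
        nlinarith
      nlinarith

theorem prod_one_add_add_le (P : Finset ℕ) {g t : ℕ → ℝ} (hg : ∀ p ∈ P, 0 ≤ g p)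
    (ht : ∀ p ∈ P, 0 ≤ t p) :
    ∏ p ∈ P, (1 + g p + t p) ≤ (∏ p ∈ P, (1 + g p)) * Real.exp (∑ p ∈ P, t p) := by
  rw [Real.exp_sum, ← Finset.prod_mul_distrib]
  refine Finset.prod_le_prod (fun p hp => by linarith [hg p hp, ht p hp]) fun p hp => ?_
  have h1 := Real.add_one_le_exp (t p)
  calc 1 + g p + t p ≤ (1 + g p) * (t p + 1) := by nlinarith [hg p hp, ht p hp]
    _ ≤ _ := by have := hg p hp; gcongr

theorem exp_le_one_add_mul {η u : ℝ} (hη : η ≤ 1) (hu0 : 0 ≤ u) (hu : u ≤ η) :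
    Real.exp u ≤ 1 + (1 + η) * u := by
  have h := (abs_le.1 (Real.abs_exp_sub_one_sub_id_le (x := u) (by
    rw [abs_of_nonneg hu0]; linarith))).2
  nlinarith

/-- The lower bound for the collision sum, and Rankin's bound for the pairs with a large quotient,
under explicit conditions on the parameters. -/
theorem resonator_bounds {P : Finset ℕ} (hP : ∀ p ∈ P, p.Prime) {q : ℕ} (hPq : ∀ p ∈ P, ¬ p ∣ q)
    {η σ L Y W α κ : ℝ} (hη0 : 0 < η) (hη : η ≤ 1)
    (hσ : σ = ∑ p ∈ P, 1 / ((p : ℝ) * Real.log p)) (hL : 0 < L) (hLY : L ^ 2 * σ = (1 - η) * Y)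
    (hW : 0 < W) (hα : 0 ≤ α)
    (hf : ∀ p ∈ P, primeWeight L p ^ 2 ≤ η ^ 2 / 4) (hαP : ∀ p ∈ P, α * Real.log p ≤ η)
    (hαY : 3 * (L * σ) + 2 ≤ η ^ 2 * (α * Y)) (hαW : 6 * (L * σ) + 2 ≤ α * Real.log √W)
    {J : ℕ} (hJ : 0 < J) (hDJ : √W < 2 ^ J)
    (h𝒦 : ∀ j < J, ∃ 𝒦 : Finset ℕ, κ * (W / 2 ^ (j + 1)) ≤ (𝒦.card : ℝ) ∧
      ∀ k ∈ 𝒦, k.Prime ∧ k ∉ P ∧ ¬ k ∣ q ∧ (k : ℝ) * 2 ^ (j + 1) ≤ W) (hκ : 0 ≤ κ) :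
    (∏ p ∈ P, (1 + primeWeight L p ^ 2)) * W * Real.exp (2 * ((1 - η) * (L * σ))) * κ ≤
        8 * (J : ℝ) ^ 2 * collisionSum W q (resonatorSupport P (Real.exp Y))
          (resonatorWeight (primeWeight L)) ∧
      ∑ m ∈ resonatorSupport P (Real.exp Y), ∑ n ∈ resonatorSupport P (Real.exp Y),
        (if W < ((max m n / m.gcd n : ℕ) : ℝ) then
          resonatorWeight (primeWeight L) m * resonatorWeight (primeWeight L) n /
            ((max m n / m.gcd n : ℕ) : ℝ) else 0) ≤
      ∏ p ∈ P, (1 + primeWeight L p ^ 2) := by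
  set f := primeWeight L with hfdef
  have hf0 : ∀ p, 0 ≤ f p := primeWeight_nonneg hL.le
  set V := ∏ p ∈ P, (1 + f p ^ 2) with hV
  have hV0 : 0 < V := Finset.prod_pos fun p _ => by positivity
  have hh0 : ∀ p : ℕ, 0 ≤ f p / √(p : ℝ) := fun p => div_nonneg (hf0 p) (Real.sqrt_nonneg _)
  have hsum : ∑ p ∈ P, f p / √(p : ℝ) = L * σ := by
    rw [hσ, Finset.mul_sum]
    exact Finset.sum_congr rfl fun p _ => primeWeight_div_sqrt L p
  have hlog0 : ∀ p : ℕ, 0 ≤ Real.log p := fun p => Real.log_natCast_nonneg p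
  have hσ0 : 0 ≤ σ := by
    rw [hσ]; exact Finset.sum_nonneg fun p _ => by have := hlog0 p; positivity
  have hLσ : 0 ≤ L * σ := by positivity
  -- on `P` the factor `p ^ α` is close to `1`
  have hpα : ∀ p ∈ P, (p : ℝ) ^ α ≤ 1 + (1 + η) * (α * Real.log p) := by
    intro p hp
    have hp0 : (0 : ℝ) < p := by exact_mod_cast (hP p hp).pos
    rw [Real.rpow_def_of_pos hp0, mul_comm (Real.log p)]
    exact exp_le_one_add_mul hη (mul_nonneg hα (hlog0 p)) (hαP p hp)
  have hpα1 : ∀ p ∈ P, 1 ≤ (p : ℝ) ^ α := fun p hp =>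
    Real.one_le_rpow (by exact_mod_cast (hP p hp).one_le) hα
  have hpα3 : ∀ p ∈ P, (p : ℝ) ^ α ≤ 3 := fun p hp => by
    have h1 := hpα p hp
    have h2 := hαP p hp
    have h3 : 0 ≤ α * Real.log p := mul_nonneg hα (hlog0 p)
    nlinarith
  have hgp : ∀ p ∈ P, f p ^ 2 * ((p : ℝ) ^ α - 1) ≤
      (1 + η) * α * L ^ 2 * (1 / ((p : ℝ) * Real.log p)) := by
    intro p hp
    have hlp : 0 < Real.log p := Real.log_pos (by exact_mod_cast (hP p hp).one_lt)
    have h1 : (p : ℝ) ^ α - 1 ≤ (1 + η) * (α * Real.log p) := by linarith [hpα p hp]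
    calc f p ^ 2 * ((p : ℝ) ^ α - 1) ≤ f p ^ 2 * ((1 + η) * (α * Real.log p)) := by gcongr
      _ = _ := by rw [hfdef, primeWeight_sq]; field_simp
  have hexpY : Real.exp Y ^ (-α) = Real.exp (-(α * Y)) := by
    rw [← Real.exp_mul]; ring_nf
  have hfour : Real.exp (-2 : ℝ) ≤ 1 / 4 := by
    have h1 := Real.add_one_le_exp (1 : ℝ)
    have h2 : Real.exp (2 : ℝ) = Real.exp 1 * Real.exp 1 := by rw [← Real.exp_add]; norm_num
    rw [Real.exp_neg, ← one_div]
    apply one_div_le_one_div_of_le (by norm_num)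
    nlinarith
  have hD0 : 0 < √W := Real.sqrt_pos.2 hW
  have htail1 : Real.exp Y ^ (-α) *
      ∏ p ∈ P, (1 + f p ^ 2 * (p : ℝ) ^ α + f p / √(p : ℝ) * (p : ℝ) ^ α) ≤ V / 4 := by
    have h1 : ∏ p ∈ P, (1 + f p ^ 2 * (p : ℝ) ^ α + f p / √(p : ℝ) * (p : ℝ) ^ α) ≤
        V * Real.exp ((1 - η ^ 2) * (α * Y) + 3 * (L * σ)) := by
      calc ∏ p ∈ P, (1 + f p ^ 2 * (p : ℝ) ^ α + f p / √(p : ℝ) * (p : ℝ) ^ α)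
          = ∏ p ∈ P, (1 + f p ^ 2 +
            (f p ^ 2 * ((p : ℝ) ^ α - 1) + f p / √(p : ℝ) * (p : ℝ) ^ α)) :=
            Finset.prod_congr rfl fun p _ => by ring
        _ ≤ V * Real.exp (∑ p ∈ P,
            (f p ^ 2 * ((p : ℝ) ^ α - 1) + f p / √(p : ℝ) * (p : ℝ) ^ α)) := by
            refine prod_one_add_add_le P (fun p _ => sq_nonneg _) fun p hp => ?_
            have := hpα1 p hp
            have := hh0 p
            exact add_nonneg (mul_nonneg (sq_nonneg _) (by linarith)) (by positivity)
        _ ≤ _ := by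
            gcongr
            rw [Finset.sum_add_distrib]
            refine add_le_add ?_ ?_
            · refine (Finset.sum_le_sum hgp).trans (le_of_eq ?_)
              rw [← Finset.mul_sum, ← hσ, mul_assoc _ (L ^ 2), hLY]; ring
            · rw [← hsum, Finset.mul_sum]
              refine Finset.sum_le_sum fun p hp => ?_
              have := mul_le_mul_of_nonneg_left (hpα3 p hp) (hh0 p)
              linarith
    calc _ ≤ Real.exp (-(α * Y)) * (V * Real.exp ((1 - η ^ 2) * (α * Y) + 3 * (L * σ))) := by
          rw [hexpY]; gcongr
      _ = V * Real.exp (-(α * Y) + ((1 - η ^ 2) * (α * Y) + 3 * (L * σ))) := by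
          rw [Real.exp_add (-(α * Y))]; ring
      _ ≤ V * Real.exp (-2) := by gcongr; linarith
      _ ≤ V * (1 / 4) := by gcongr
      _ = V / 4 := by ring
  have hrank : ∀ c : ℝ, 0 ≤ c → c ≤ 2 →
      ∏ p ∈ P, (1 + f p ^ 2 + c * (f p / √(p : ℝ) * (p : ℝ) ^ α)) ≤
        V * Real.exp (6 * (L * σ)) := by
    intro c hc0 hc
    refine (prod_one_add_add_le P (fun p _ => sq_nonneg _) fun p hp => ?_).trans ?_
    · have := hh0 p; positivity
    · gcongr
      rw [← hsum, Finset.mul_sum]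
      refine Finset.sum_le_sum fun p hp => ?_
      have h1 := mul_le_mul_of_nonneg_left (hpα3 p hp) (hh0 p)
      have h2 : 0 ≤ f p / √(p : ℝ) * (p : ℝ) ^ α := by have := hh0 p; positivity
      nlinarith
  have hDα : √W ^ (-α) * (V * Real.exp (6 * (L * σ))) ≤ V / 4 := by
    rw [Real.rpow_def_of_pos hD0]
    calc _ = V * Real.exp (Real.log √W * -α + 6 * (L * σ)) := by rw [Real.exp_add]; ring
      _ ≤ V * Real.exp (-2) := by gcongr; linarith
      _ ≤ V * (1 / 4) := by gcongr
      _ = V / 4 := by ring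
  have htail2 : √W ^ (-α) * ∏ p ∈ P, (1 + f p ^ 2 + f p / √(p : ℝ) * (p : ℝ) ^ α) ≤ V / 4 := by
    refine le_trans ?_ hDα
    gcongr
    simpa using hrank 1 zero_le_one one_le_two
  constructor
  · have hfull : V * Real.exp ((1 - η) * (L * σ)) ≤ ∏ p ∈ P, (1 + f p ^ 2 + f p / √(p : ℝ)) := by
      rw [← hsum, Finset.mul_sum, Real.exp_sum, hV, ← Finset.prod_mul_distrib]
      refine Finset.prod_le_prod (fun p _ => by positivity) fun p hp => ?_
      have hp1 : (1 : ℝ) ≤ p := by exact_mod_cast (hP p hp).one_le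
      have hfp := hf p hp
      have h1 : f p ≤ η / 2 := by
        refine (sq_le_sq₀ (hf0 p) (by positivity)).1 ?_
        linarith [show (η / 2) ^ 2 = η ^ 2 / 4 by ring]
      refine one_add_mul_exp_le hη0.le hη (sq_nonneg _) (hh0 p) ?_ ?_
      · nlinarith
      · exact (div_le_self (hf0 p) (Real.one_le_sqrt.2 hp1)).trans h1
    have hZ := prod_sub_tails_le P (g := fun p => f p ^ 2) (h := fun p => f p / √(p : ℝ))
      (fun p => sq_nonneg _) hh0 (Real.exp_pos Y) hD0 hα
    set Z := ∑ S ∈ P.powerset.filter (fun S => ((∏ p ∈ S, p : ℕ) : ℝ) ≤ Real.exp Y),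
        ∑ T ∈ S.powerset.filter (fun T => ((∏ p ∈ T, p : ℕ) : ℝ) ≤ √W),
          (∏ p ∈ T, f p / √(p : ℝ)) * ∏ p ∈ S \ T, f p ^ 2 with hZdef
    have hexp1 : 1 ≤ Real.exp ((1 - η) * (L * σ)) :=
      Real.one_le_exp (mul_nonneg (by linarith) hLσ)
    have hZ2 : V / 2 * Real.exp ((1 - η) * (L * σ)) ≤ Z := by
      have : V ≤ V * Real.exp ((1 - η) * (L * σ)) := le_mul_of_one_le_right hV0.le hexp1
      linarith
    have hcol := sq_le_collisionSum (y := Real.exp Y) hP hPq hf0 hW.le hJ hDJ h𝒦 (by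
      rw [← hZdef]; exact le_trans (by positivity) hZ2)
    rw [← hZdef] at hcol
    have hρ := sum_resonatorWeight_sq_le hP f (Real.exp Y)
    set Col := collisionSum W q (resonatorSupport P (Real.exp Y)) (resonatorWeight f) with hCol
    have hCol0 : 0 ≤ Col := by
      refine Finset.sum_nonneg fun x _ => Finset.sum_nonneg fun y _ => ?_
      split_ifs
      · exact mul_nonneg (Finset.prod_nonneg fun p _ => hf0 p)
          (Finset.prod_nonneg fun p _ => hf0 p)
      · exact le_rfl
    have h1 : κ * W * (V / 2 * Real.exp ((1 - η) * (L * σ))) ^ 2 ≤ 2 * (J : ℝ) ^ 2 * (V * Col) := by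
      calc _ ≤ κ * W * Z ^ 2 := by gcongr
        _ ≤ _ := hcol
        _ ≤ _ := by gcongr
    have h2 : κ * W * (V / 2 * Real.exp ((1 - η) * (L * σ))) ^ 2 =
        V * (V * W * Real.exp (2 * ((1 - η) * (L * σ))) * κ) / 4 := by
      rw [mul_pow, ← Real.exp_nat_mul]; push_cast; ring
    rw [h2] at h1
    refine le_of_mul_le_mul_left ?_ hV0
    linarith
  · refine (sum_large_quotient_le hP hf0 hW hα).trans ?_
    have h1 : W ^ (-α) ≤ √W ^ (-α) := by
      have hlW : 0 ≤ Real.log √W := by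
        by_contra hneg
        have := mul_nonpos_of_nonneg_of_nonpos hα (not_le.1 hneg).le
        linarith
      have hW1 : 1 ≤ √W := (Real.log_nonneg_iff hD0).1 hlW
      apply Real.rpow_le_rpow_of_nonpos hD0 _ (by linarith)
      calc √W ≤ √W * √W := le_mul_of_one_le_left hD0.le hW1
        _ = W := Real.mul_self_sqrt hW.le
    calc _ ≤ √W ^ (-α) * (V * Real.exp (6 * (L * σ))) :=
          mul_le_mul h1 (hrank 2 zero_le_two le_rfl)
            (Finset.prod_nonneg fun p _ => by have := hh0 p; positivity) (by positivity)
      _ ≤ V / 4 := hDα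
      _ ≤ V := by linarith

/-! ### Choice of the parameters -/

open Filter in
/-- The growth conditions on `x = log q` used in choosing the parameters of the resonator. -/
theorem eventually_log_conditions (A : ℝ) :
    ∀ᶠ x : ℝ in atTop, A ≤ x ∧ A ≤ Real.log x ∧ A ≤ Real.log (Real.log x) ∧
      A * Real.log x ≤ √(x / Real.log x) := by
  have hlog := Real.tendsto_log_atTop
  have ho := (Real.isLittleO_pow_log_id_atTop (n := 3)).bound
    (show (0 : ℝ) < 1 / (A ^ 2 + 1) by positivity)
  filter_upwards [eventually_ge_atTop A, hlog.eventually_ge_atTop A,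
    (hlog.comp hlog).eventually_ge_atTop A, ho, eventually_gt_atTop 1] with x h1 h2 h3 h4 h5
  refine ⟨h1, h2, h3, ?_⟩
  have hl : 0 < Real.log x := Real.log_pos h5
  apply Real.le_sqrt_of_sq_le
  rw [le_div_iff₀ hl]
  rw [Real.norm_of_nonneg (by positivity), id, Real.norm_of_nonneg (by linarith),
    one_div, inv_mul_eq_div, le_div_iff₀ (by positivity)] at h4
  calc (A * Real.log x) ^ 2 * Real.log x = Real.log x ^ 3 * A ^ 2 := by ring
    _ ≤ Real.log x ^ 3 * (A ^ 2 + 1) := by gcongr; linarith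
    _ ≤ x := h4

/-- The auxiliary primes: for `2 ^ j ≤ √W` there are many primes `k ≤ W / 2 ^ (j + 1)` that neither
divide `q` nor lie in the resonator's set of primes. -/
theorem exists_auxiliary_primes {K : ℝ} (hK : 1 ≤ K) {q : ℕ} (hq : q ≠ 0) {W : ℝ}
    (hx : 56 ≤ Real.log q) (hW : 0 < W) (hWq : W ≤ q)
    (hWl : (K + 3) * Real.log (Real.log q) ≤ Real.log √W) {j : ℕ} (hj : (2 : ℝ) ^ j ≤ √W) :
    ∃ 𝒦 : Finset ℕ, 1 / (4 * Real.log q) * (W / 2 ^ (j + 1)) ≤ (𝒦.card : ℝ) ∧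
      ∀ k ∈ 𝒦, k.Prime ∧ k ∉ resonatorPrimes K q ∧ ¬ k ∣ q ∧ (k : ℝ) * 2 ^ (j + 1) ≤ W := by
  set x := Real.log q with hxdef
  have hx0 : 0 < x := by linarith
  set z := W / 2 ^ (j + 1) with hz
  have hD0 : 0 < √W := Real.sqrt_pos.2 hW
  have hxK : x ≤ x ^ K := Real.self_le_rpow_of_one_le (by linarith) hK
  have hzD : √W / 2 ≤ z := by
    rw [hz, pow_succ, le_div_iff₀ (by positivity)]
    calc √W / 2 * (2 ^ j * 2) = √W * 2 ^ j := by ring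
      _ ≤ √W * √W := by gcongr
      _ = W := Real.mul_self_sqrt hW.le
  have hWx : x ^ K * x * x * x ≤ √W := by
    rw [← Real.log_le_log_iff (by positivity) hD0, Real.log_mul (by positivity) hx0.ne',
      Real.log_mul (by positivity) hx0.ne', Real.log_mul (by positivity) hx0.ne',
      Real.log_rpow hx0]
    linarith
  have hlarge : 4 * x * (x ^ K + 3 * x + 2) ≤ z := by
    refine le_trans ?_ hzD
    have h1 : x ^ K + 3 * x + 2 ≤ 6 * x ^ K := by linarith
    have h2 : 0 ≤ x ^ K * x := by positivity
    calc 4 * x * (x ^ K + 3 * x + 2) ≤ 4 * x * (6 * x ^ K) := by gcongr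
      _ = (x ^ K * x) * 48 / 2 := by ring
      _ ≤ (x ^ K * x) * (x * x) / 2 := by gcongr; nlinarith
      _ ≤ √W / 2 := by linarith
  have hz4 : 4 ≤ z := by
    refine le_trans ?_ hlarge
    nlinarith
  have hzq : z ≤ q := by
    refine le_trans ?_ hWq
    exact div_le_self hW.le (one_le_pow₀ (by norm_num))
  refine ⟨(primesIoc (x ^ K) z).filter fun p => ¬ p ∣ q, ?_, ?_⟩
  · have := card_primesIoc_not_dvd_ge hq (u := x ^ K) hz4 (by positivity) hzq hlarge
    rwa [one_div, inv_mul_eq_div]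
  · intro k hk
    rw [Finset.mem_filter, mem_primesIoc (by linarith)] at hk
    refine ⟨hk.1.1, ?_, hk.2, ?_⟩
    · rw [mem_resonatorPrimes]
      rintro ⟨-, -, h, -⟩
      linarith [hk.1.2.1]
    · rw [← le_div_iff₀ (by positivity)]
      exact hk.1.2.2

theorem collisionSum_nonneg {W : ℝ} {q : ℕ} {M : Finset ℕ} {r : ℕ → ℝ} (hr : ∀ m, 0 ≤ r m) :
    0 ≤ collisionSum W q M r := by
  refine Finset.sum_nonneg fun x _ => Finset.sum_nonneg fun y _ => ?_
  split_ifs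
  · exact mul_nonneg (hr _) (hr _)
  · exact le_rfl

open Filter in
set_option maxHeartbeats 1000000 in
/-- Existence of the resonator: coefficients `r` on integers `m ≤ exp Y`, with a large collision sum
and with little weight on the pairs whose quotients are not both at most `W`. The quantity `V` is
`∏ (1 + r(p) ^ 2)`, the second moment of the coefficients before the restriction to
`m ≤ exp Y`. -/
theorem exists_resonator {ε η : ℝ} (hε : 0 < ε) (hη0 : 0 < η) (hη : η < 1) :
    ∀ᶠ q : ℕ in atTop, ∀ W Y : ℝ, 0 < W → W ≤ q →
      2 * √(Real.log q * Real.log (Real.log q)) * Real.log (Real.log (Real.log q)) ≤ Real.log W →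
      ε * Real.log q ≤ Y → Y ≤ Real.log q →
      ∃ (M : Finset ℕ) (r : ℕ → ℝ) (V : ℝ),
        (∀ m ∈ M, 1 ≤ m ∧ (m : ℝ) ≤ Real.exp Y ∧ m.Coprime q) ∧ (∀ m, 0 ≤ r m) ∧
        0 < ∑ m ∈ M, r m ^ 2 ∧ ∑ m ∈ M, r m ^ 2 ≤ V ∧
        V * W * Real.exp (2 * (1 - 3 * η) * √(Y / Real.log (Real.log q))) ≤
          collisionSum W q M r ∧
        ∑ m ∈ M, ∑ n ∈ M, (if W < ((max m n / m.gcd n : ℕ) : ℝ) then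
          r m * r n / ((max m n / m.gcd n : ℕ) : ℝ) else 0) ≤ V := by
  obtain ⟨K, hK, hσlow⟩ := exists_sum_resonatorPrimes_ge hη0
  obtain ⟨C, hC, hσup⟩ := exists_sum_resonatorPrimes_le hK
  -- every condition below holds once the quantities in `eventually_log_conditions` exceed `A`
  obtain ⟨A, hA1, hA2, hA3, hA4, hA5, hA6⟩ : ∃ A : ℝ, 56 ≤ A ∧ 4 / η ^ 2 ≤ A ∧
      K / (η ^ 3 * ε) * (3 * √C + 2) ≤ A ∧ K / η * (6 * √C + 2) ≤ A ∧ K + 3 ≤ A ∧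
      (7 / (2 * η * √ε)) ≤ A := by
    refine ⟨max 56 (max (4 / η ^ 2) (max (K / (η ^ 3 * ε) * (3 * √C + 2))
      (max (K / η * (6 * √C + 2)) (max (K + 3) (7 / (2 * η * √ε)))))), ?_⟩
    simp only [le_max_iff, le_refl, true_or, or_true, and_self]
  filter_upwards [hσlow, hσup, tendsto_log_natCast.eventually (eventually_log_conditions A),
    eventually_ne_atTop 0] with q hs1 hs2 hq hq0 W Y hW hWq hWl hεY hY
  set x := Real.log q with hx
  set ℓ := Real.log x with hℓ
  set P := resonatorPrimes K q with hP
  set σ := ∑ p ∈ P, 1 / ((p : ℝ) * Real.log p) with hσ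
  obtain ⟨hx1, hx2, hx3, hx4⟩ := hq
  have hx0 : 0 < x := by linarith
  have hℓ0 : 0 < ℓ := by linarith
  have hK0 : 0 < K := by linarith
  set s := √(x / ℓ) with hs
  have hs2' : s ^ 2 = x / ℓ := Real.sq_sqrt (by positivity)
  have hsA : A ≤ s := (le_mul_of_one_le_right (by linarith) (by linarith)).trans hx4
  have hs0 : 0 < s := by linarith
  have hη1 : 0 < 1 - η := by linarith
  have hσ0 : 0 < σ := lt_of_lt_of_le (by positivity) hs1
  have hY0 : 0 < Y := lt_of_lt_of_le (by positivity) hεY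
  -- `L ^ 2 * σ` is about the mean of `log m` under the weights `r(m) ^ 2`, to be kept below `Y`
  set L := √((1 - η) * Y / σ) with hL
  have hL0 : 0 < L := Real.sqrt_pos.2 (by positivity)
  have hL2 : L ^ 2 = (1 - η) * Y / σ := Real.sq_sqrt (by positivity)
  have hLY : L ^ 2 * σ = (1 - η) * Y := by rw [hL2]; field_simp
  have hLσsq : (L * σ) ^ 2 = (1 - η) * Y * σ := by rw [mul_pow, sq σ, ← mul_assoc, hLY]
  have hLσ_up : L * σ ≤ √C * s := by
    rw [hs, ← Real.sqrt_mul hC.le]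
    apply Real.le_sqrt_of_sq_le
    rw [hLσsq]
    calc (1 - η) * Y * σ ≤ 1 * x * (C / ℓ) := by gcongr; linarith
      _ = C * (x / ℓ) := by ring
  have hLσ_low : (1 - η) * √(Y / ℓ) ≤ L * σ := by
    refine (sq_le_sq₀ (by positivity) (by positivity)).1 ?_
    rw [mul_pow, Real.sq_sqrt (by positivity), hLσsq]
    calc (1 - η) ^ 2 * (Y / ℓ) = (1 - η) * Y * ((1 - η) / ℓ) := by ring
      _ ≤ _ := by gcongr
  have hPprime : ∀ p ∈ P, p.Prime := fun p hp => (mem_resonatorPrimes.1 hp).1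
  have hPq : ∀ p ∈ P, ¬ p ∣ q := fun p hp => (mem_resonatorPrimes.1 hp).2.2.2
  have hLup : L ^ 2 ≤ x * ℓ := by
    rw [hL2, div_le_iff₀ hσ0]
    calc (1 - η) * Y ≤ (1 - η) * x := by gcongr
      _ = x * ℓ * ((1 - η) / ℓ) := by field_simp
      _ ≤ _ := by gcongr
  have hf : ∀ p ∈ P, primeWeight L p ^ 2 ≤ η ^ 2 / 4 := by
    intro p hp
    have hxp := (mem_resonatorPrimes.1 hp).2.1
    rw [← hx] at hxp
    have hlp : ℓ ≤ Real.log p := Real.log_le_log hx0 hxp.le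
    have hp0 : (0 : ℝ) < p := by linarith
    rw [primeWeight_sq]
    calc L ^ 2 * (1 / (p * Real.log p)) / Real.log p ≤ (x * ℓ) * (1 / (x * ℓ)) / ℓ := by gcongr
      _ = 1 / ℓ := by field_simp
      _ ≤ η ^ 2 / 4 := by
        rw [div_le_div_iff₀ hℓ0 (by norm_num)]
        have := (div_le_iff₀ (by positivity)).1 (hA2.trans hx2)
        linarith
  -- Rankin's exponent, small enough for `p ^ α` to be close to `1` at all primes of `P`
  set α := η / (K * ℓ) with hα
  have hα0 : 0 < α := by positivity
  have hαP : ∀ p ∈ P, α * Real.log p ≤ η := by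
    intro p hp
    have h1 := (mem_resonatorPrimes.1 hp).2.2.1
    rw [← hx] at h1
    have hp0 : (0 : ℝ) < p := by exact_mod_cast (hPprime p hp).pos
    have hlp : Real.log p ≤ K * ℓ := by
      have := Real.log_le_log hp0 h1
      rwa [Real.log_rpow hx0] at this
    calc α * Real.log p ≤ α * (K * ℓ) := by gcongr
      _ = η := by rw [hα]; field_simp
  have hαY : 3 * (L * σ) + 2 ≤ η ^ 2 * (α * Y) := by
    have h1 : η ^ 3 * ε / K * s ^ 2 ≤ η ^ 2 * (α * Y) := by
      rw [hs2', hα]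
      calc η ^ 3 * ε / K * (x / ℓ) = η ^ 2 * (η / (K * ℓ) * (ε * x)) := by field_simp
        _ ≤ _ := by gcongr
    have h2 : 3 * √C + 2 ≤ η ^ 3 * ε / K * s := by
      have := hA3.trans hsA
      rw [div_mul_eq_mul_div, div_le_iff₀ (by positivity)] at this
      rw [div_mul_eq_mul_div, le_div_iff₀ hK0]
      linarith
    have h3 := mul_le_mul_of_nonneg_right h2 hs0.le
    have h4 : 1 ≤ s := by linarith
    calc 3 * (L * σ) + 2 ≤ 3 * (√C * s) + 2 * s := by linarith
      _ = (3 * √C + 2) * s := by ring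
      _ ≤ η ^ 3 * ε / K * s * s := h3
      _ = η ^ 3 * ε / K * s ^ 2 := by ring
      _ ≤ _ := h1
  have hlsq : Real.log √W = Real.log W / 2 := Real.log_sqrt hW.le
  have hsℓ : √(x * ℓ) = s * ℓ := by
    rw [show x * ℓ = (x / ℓ) * ℓ ^ 2 by field_simp, Real.sqrt_mul (by positivity),
      Real.sqrt_sq hℓ0.le]
  have hWl2 : s * ℓ * Real.log ℓ ≤ Real.log √W := by
    rw [hlsq]; rw [hsℓ] at hWl; linarith
  have hαW : 6 * (L * σ) + 2 ≤ α * Real.log √W := by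
    have h1 : α * (s * ℓ * Real.log ℓ) ≤ α * Real.log √W := by gcongr
    refine le_trans ?_ h1
    have h2 : α * (s * ℓ * Real.log ℓ) = s * (η / K * Real.log ℓ) := by rw [hα]; field_simp
    have h3 : 6 * √C + 2 ≤ η / K * Real.log ℓ := by
      have := hA4.trans hx3
      rw [div_mul_eq_mul_div, div_le_iff₀ hη0] at this
      rw [div_mul_eq_mul_div, le_div_iff₀ hK0]
      linarith
    rw [h2]
    have h4 : 1 ≤ s := by linarith
    have h5 := mul_le_mul_of_nonneg_left h3 hs0.le
    calc 6 * (L * σ) + 2 ≤ 6 * (√C * s) + 2 * s := by linarith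
      _ = s * (6 * √C + 2) := by ring
      _ ≤ _ := h5
  have hD0 : 0 < √W := Real.sqrt_pos.2 hW
  have hlD : (K + 3) * ℓ ≤ Real.log √W := by
    refine le_trans ?_ hWl2
    have h1 : K + 3 ≤ s := hA5.trans hsA
    have h2 : 1 ≤ Real.log ℓ := by linarith
    calc (K + 3) * ℓ ≤ s * ℓ := by gcongr
      _ ≤ s * ℓ * Real.log ℓ := le_mul_of_one_le_right (by positivity) h2
  have hD1 : 1 ≤ √W := (Real.log_nonneg_iff hD0).1 (le_trans (by positivity) hlD)
  -- the number of dyadic classes up to `√W`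
  set J := Nat.log 2 ⌊√W⌋₊ + 1 with hJ
  have hfl : ⌊√W⌋₊ ≠ 0 := by
    have : 1 ≤ ⌊√W⌋₊ := Nat.le_floor (by exact_mod_cast hD1)
    omega
  have hDJ : √W < 2 ^ J := by
    have h1 : ⌊√W⌋₊ + 1 ≤ 2 ^ J := Nat.lt_pow_succ_log_self (by norm_num) _
    have h2 : ((⌊√W⌋₊ + 1 : ℕ) : ℝ) ≤ 2 ^ J := by exact_mod_cast h1
    push_cast at h2
    linarith [Nat.lt_floor_add_one √W]
  have hJD : (2 : ℝ) ^ (J - 1) ≤ √W := by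
    have h1 : (2 : ℕ) ^ (J - 1) ≤ ⌊√W⌋₊ := Nat.pow_log_le_self 2 hfl
    have h2 : (2 : ℝ) ^ (J - 1) ≤ (⌊√W⌋₊ : ℝ) := by exact_mod_cast h1
    exact h2.trans (Nat.floor_le hD0.le)
  have hJx : (J : ℝ) ≤ x := by
    have h1 := Real.log_le_log (by positivity) hJD
    rw [Real.log_pow, hlsq] at h1
    have h2 : Real.log W ≤ x := Real.log_le_log hW hWq
    have h3 : ((J - 1 : ℕ) : ℝ) = J - 1 := by rw [hJ]; push_cast; simp
    rw [h3] at h1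
    have h4 := Real.log_two_gt_d9
    have h5 : (1 : ℝ) ≤ J := by rw [hJ]; push_cast; linarith [(Nat.log 2 ⌊√W⌋₊).cast_nonneg (α := ℝ)]
    have h6 : 0.69 * ((J : ℝ) - 1) ≤ Real.log 2 * ((J : ℝ) - 1) :=
      mul_le_mul_of_nonneg_right (by linarith) (by linarith)
    linarith
  have h𝒦 : ∀ j < J, ∃ 𝒦 : Finset ℕ, 1 / (4 * x) * (W / 2 ^ (j + 1)) ≤ (𝒦.card : ℝ) ∧
      ∀ k ∈ 𝒦, k.Prime ∧ k ∉ P ∧ ¬ k ∣ q ∧ (k : ℝ) * 2 ^ (j + 1) ≤ W := by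
    intro j hj
    refine exists_auxiliary_primes hK hq0 (hA1.trans hx1) hW hWq hlD (le_trans ?_ hJD)
    exact pow_le_pow_right₀ (by norm_num) (by omega)
  obtain ⟨hmain, htail⟩ := resonator_bounds hPprime hPq hη0 hη.le hσ hL0 hLY hW hα0.le hf hαP hαY hαW
    (Nat.succ_pos _) hDJ h𝒦 (by positivity)
  set M := resonatorSupport P (Real.exp Y) with hM
  set r := resonatorWeight (primeWeight L) with hr
  set V := ∏ p ∈ P, (1 + primeWeight L p ^ 2) with hV
  have hr0 : ∀ m, 0 ≤ r m := fun m => Finset.prod_nonneg fun p _ => primeWeight_nonneg hL0.le p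
  have hV0 : 0 < V := Finset.prod_pos fun p _ => by positivity
  refine ⟨M, r, V, ?_, hr0, ?_, sum_resonatorWeight_sq_le hPprime _ _, ?_, htail⟩
  · intro m hm
    rw [hM, resonatorSupport, Finset.mem_image] at hm
    obtain ⟨S, hS, rfl⟩ := hm
    rw [Finset.mem_filter, Finset.mem_powerset] at hS
    refine ⟨prod_pos_of_primes fun p hp => hPprime p (hS.1 hp), hS.2,
      Nat.Coprime.prod_left fun p hp => ?_⟩
    exact (Nat.Prime.coprime_iff_not_dvd (hPprime p (hS.1 hp))).2 (hPq p (hS.1 hp))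
  · have h1 : 1 ∈ M := by
      rw [hM, resonatorSupport, Finset.mem_image]
      refine ⟨∅, ?_, by simp⟩
      rw [Finset.mem_filter]
      simpa using hY0.le
    refine lt_of_lt_of_le ?_ (Finset.single_le_sum (f := fun m => r m ^ 2)
      (fun m _ => sq_nonneg _) h1)
    simp [hr, resonatorWeight]
  · set u := √(Y / ℓ) with hu
    have hu0 : 0 ≤ u := Real.sqrt_nonneg _
    have hCol0 := collisionSum_nonneg (W := W) (q := q) (M := M) hr0
    -- the factor `32 x ^ 3` lost on the way is absorbed into the exponential
    have hpoly : 32 * x ^ 3 ≤ Real.exp (2 * η * u) := by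
      rw [← Real.log_le_iff_le_exp (by positivity), Real.log_mul (by norm_num) (by positivity),
        Real.log_pow]
      have h32 : Real.log 32 ≤ 4 * ℓ := by
        rw [show (32 : ℝ) = 2 ^ 5 by norm_num, Real.log_pow]
        have := Real.log_two_lt_d9
        push_cast
        linarith
      have h1 : √ε * s ≤ u := by
        rw [hs, hu, ← Real.sqrt_mul hε.le]
        apply Real.sqrt_le_sqrt
        rw [← mul_div_assoc]
        gcongr
      have h2 : 7 * ℓ ≤ 2 * η * (√ε * s) := by
        have h3 : 7 / (2 * η * √ε) * ℓ ≤ s := le_trans (by gcongr) hx4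
        have : 0 < √ε := Real.sqrt_pos.2 hε
        rw [div_mul_eq_mul_div, div_le_iff₀ (by positivity)] at h3
        linarith
      have h4 : 2 * η * (√ε * s) ≤ 2 * η * u := by gcongr
      push_cast
      linarith
    have hmain2 : V * W * Real.exp (2 * ((1 - η) * (L * σ))) ≤ 32 * x ^ 3 *
        collisionSum W q M r := by
      rw [mul_one_div, div_le_iff₀ (by positivity)] at hmain
      calc _ ≤ 8 * (J : ℝ) ^ 2 * collisionSum W q M r * (4 * x) := hmain
        _ ≤ 8 * x ^ 2 * collisionSum W q M r * (4 * x) := by gcongr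
        _ = _ := by ring
    have h5 : 2 * (1 - 3 * η) * u + 2 * η * u ≤ 2 * ((1 - η) * (L * σ)) := by
      have : (1 - η) * ((1 - η) * u) ≤ (1 - η) * (L * σ) := by gcongr
      linarith [mul_nonneg (sq_nonneg η) hu0]
    refine le_of_mul_le_mul_left ?_ (show 0 < 32 * x ^ 3 by positivity)
    calc 32 * x ^ 3 * (V * W * Real.exp (2 * (1 - 3 * η) * u))
        ≤ Real.exp (2 * η * u) * (V * W * Real.exp (2 * (1 - 3 * η) * u)) := by gcongr
      _ = V * W * Real.exp (2 * (1 - 3 * η) * u + 2 * η * u) := by rw [Real.exp_add]; ring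
      _ ≤ V * W * Real.exp (2 * ((1 - η) * (L * σ))) := by gcongr
      _ ≤ _ := hmain2

/-! ### Character sums and orthogonality -/

theorem conj_char_apply {q : ℕ} [NeZero q] (χ : DirichletCharacter ℂ q) {a : ZMod q}
    (ha : IsUnit a) : (starRingEnd ℂ) (χ a) = χ a⁻¹ := by
  obtain ⟨u, rfl⟩ := ha
  have h1 : ‖χ (u : ZMod q)‖ = 1 := DirichletCharacter.unit_norm_eq_one χ u
  rw [← Complex.inv_eq_conj h1]
  symm
  apply eq_inv_of_mul_eq_one_left
  rw [← map_mul, ZMod.inv_mul_of_unit _ u.isUnit, map_one]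

/-- Orthogonality: the second moment over all characters of a character polynomial. -/
theorem sum_norm_sq_char_sum {q : ℕ} [NeZero q] {ι : Type*} (s : Finset ι) (c : ι → ℝ)
    (a : ι → ZMod q) (ha : ∀ i ∈ s, IsUnit (a i)) :
    ∑ χ : DirichletCharacter ℂ q, ‖∑ i ∈ s, (c i : ℂ) * χ (a i)‖ ^ 2 =
      q.totient * ∑ i ∈ s, ∑ j ∈ s, (if a i = a j then c i * c j else 0) := by
  have h1 : ∀ χ : DirichletCharacter ℂ q, ((‖∑ i ∈ s, (c i : ℂ) * χ (a i)‖ ^ 2 : ℝ) : ℂ) =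
      ∑ i ∈ s, ∑ j ∈ s, (c i : ℂ) * c j * (χ (a i)⁻¹ * χ (a j)) := by
    intro χ
    rw [Complex.ofReal_pow, ← Complex.conj_mul', map_sum, Finset.sum_mul]
    refine Finset.sum_congr rfl fun i hi => ?_
    rw [Finset.mul_sum]
    refine Finset.sum_congr rfl fun j _ => ?_
    rw [map_mul, conj_char_apply χ (ha i hi), Complex.conj_ofReal]
    ring
  have h2 : ((∑ χ : DirichletCharacter ℂ q, ‖∑ i ∈ s, (c i : ℂ) * χ (a i)‖ ^ 2 : ℝ) : ℂ) =
      ((q.totient * ∑ i ∈ s, ∑ j ∈ s, (if a i = a j then c i * c j else 0) : ℝ) : ℂ) := by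
    rw [Complex.ofReal_sum, Finset.sum_congr rfl fun χ _ => h1 χ, Finset.sum_comm]
    push_cast
    rw [Finset.mul_sum]
    refine Finset.sum_congr rfl fun i hi => ?_
    rw [Finset.sum_comm, Finset.mul_sum]
    refine Finset.sum_congr rfl fun j _ => ?_
    rw [← Finset.mul_sum, DirichletCharacter.sum_char_inv_mul_char_eq ℂ (ha i hi)]
    split_ifs <;> push_cast <;> ring
  exact_mod_cast h2

theorem norm_char_sum_le_charSumSup (t : ℝ) {q : ℕ} [NeZero q] {χ : DirichletCharacter ℂ q}
    (hχ : χ ≠ 1) : ‖∑ n ∈ Finset.Icc 1 ⌊t⌋₊, χ (n : ZMod q)‖ ≤ charSumSup t q := by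
  have hb : BddAbove (Set.range fun χ : {χ : DirichletCharacter ℂ q // χ ≠ 1} =>
      ‖∑ n ∈ Finset.Icc 1 ⌊t⌋₊, (χ : DirichletCharacter ℂ q) (n : ZMod q)‖) :=
    (Set.finite_range _).bddAbove
  exact le_ciSup hb ⟨χ, hχ⟩

theorem charSumSup_nonneg (t : ℝ) (q : ℕ) : 0 ≤ charSumSup t q :=
  Real.iSup_nonneg fun _ => norm_nonneg _

/-- The resonance inequality, with the contribution of the principal character split off. -/
theorem sum_norm_sq_mul_le {t : ℝ} {q : ℕ} [NeZero q] (R : DirichletCharacter ℂ q → ℂ) :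
    ∑ χ : DirichletCharacter ℂ q,
        ‖(∑ n ∈ Finset.Icc 1 ⌊t⌋₊, χ (n : ZMod q)) * R χ‖ ^ 2 ≤
      ‖(∑ n ∈ Finset.Icc 1 ⌊t⌋₊, (1 : DirichletCharacter ℂ q) (n : ZMod q)) * R 1‖ ^ 2 +
        charSumSup t q ^ 2 * ∑ χ : DirichletCharacter ℂ q, ‖R χ‖ ^ 2 := by
  classical
  rw [← Finset.add_sum_erase _ _ (Finset.mem_univ (1 : DirichletCharacter ℂ q))]
  gcongr
  rw [Finset.mul_sum]
  refine le_trans (Finset.sum_le_sum fun χ hχ => ?_)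
    (Finset.sum_le_sum_of_subset_of_nonneg (Finset.erase_subset _ _) fun χ _ _ => by positivity)
  rw [norm_mul, mul_pow]
  gcongr
  exact norm_char_sum_le_charSumSup t (Finset.ne_of_mem_erase hχ)

theorem sum_Icc_char_eq (t : ℝ) {q : ℕ} (χ : DirichletCharacter ℂ q) :
    ∑ n ∈ Finset.Icc 1 ⌊t⌋₊, χ (n : ZMod q) = ∑ n ∈ coprimesUpTo t q, χ (n : ZMod q) := by
  rw [coprimesUpTo, Finset.sum_filter]
  refine Finset.sum_congr rfl fun n _ => ?_
  split_ifs with h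
  · rfl
  · exact χ.map_nonunit fun hu => h ((ZMod.isUnit_iff_coprime n q).1 hu)

section

variable {q : ℕ} {M : Finset ℕ} {r : ℕ → ℝ}

/-- The second moment of the product of the character sum and the resonator counts the weighted
solutions of `n₁ m₁ ≡ n₂ m₂ (mod q)`. -/
theorem sum_norm_sq_char_sum_mul_resonator [NeZero q] (t : ℝ) (hMq : ∀ m ∈ M, m.Coprime q) :
    ∑ χ : DirichletCharacter ℂ q, ‖(∑ n ∈ Finset.Icc 1 ⌊t⌋₊, χ (n : ZMod q)) *
        ∑ m ∈ M, (r m : ℂ) * χ (m : ZMod q)‖ ^ 2 =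
      q.totient * ∑ x ∈ coprimesUpTo t q ×ˢ M, ∑ y ∈ coprimesUpTo t q ×ˢ M,
        (if ((x.1 * x.2 : ℕ) : ZMod q) = ((y.1 * y.2 : ℕ) : ZMod q)
          then r x.2 * r y.2 else 0) := by
  rw [← sum_norm_sq_char_sum _ (fun x : ℕ × ℕ => r x.2)
    (fun x : ℕ × ℕ => ((x.1 * x.2 : ℕ) : ZMod q))]
  · refine Finset.sum_congr rfl fun χ _ => ?_
    rw [sum_Icc_char_eq, Finset.sum_mul_sum, ← Finset.sum_product']
    congr 2
    refine Finset.sum_congr rfl fun x _ => ?_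
    rw [Nat.cast_mul, map_mul]; ring
  · intro x hx
    rw [Finset.mem_product, coprimesUpTo, Finset.mem_filter] at hx
    rw [ZMod.isUnit_iff_coprime]
    exact hx.1.2.mul_left (hMq _ hx.2)

theorem sum_norm_sq_resonator [NeZero q] (hMq : ∀ m ∈ M, m.Coprime q) (hM : ∀ m ∈ M, m < q) :
    ∑ χ : DirichletCharacter ℂ q, ‖∑ m ∈ M, (r m : ℂ) * χ (m : ZMod q)‖ ^ 2 =
      q.totient * ∑ m ∈ M, r m ^ 2 := by
  rw [sum_norm_sq_char_sum M r (fun m => (m : ZMod q))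
    fun m hm => (ZMod.isUnit_iff_coprime m q).2 (hMq m hm)]
  congr 1
  refine Finset.sum_congr rfl fun m hm => ?_
  rw [Finset.sum_eq_single_of_mem m hm]
  · rw [if_pos rfl, sq]
  · intro n hn hnm
    rw [if_neg]
    intro h
    rw [ZMod.natCast_eq_natCast_iff, Nat.ModEq, Nat.mod_eq_of_lt (hM m hm),
      Nat.mod_eq_of_lt (hM n hn)] at h
    exact hnm h.symm

theorem norm_sum_one_char_le (t : ℝ) (ht : 0 ≤ t) :
    ‖∑ n ∈ Finset.Icc 1 ⌊t⌋₊, (1 : DirichletCharacter ℂ q) (n : ZMod q)‖ ≤ t := by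
  refine (norm_sum_le_of_le (f := fun n : ℕ => (1 : DirichletCharacter ℂ q) (n : ZMod q))
    (n := fun _ => 1) _ fun n _ => DirichletCharacter.norm_le_one _ _).trans ?_
  simpa using Nat.floor_le ht

theorem sq_sum_le_mul_sum_sq {y : ℝ} (hM : ∀ m ∈ M, 1 ≤ m ∧ (m : ℝ) ≤ y) (hy : 0 ≤ y) :
    (∑ m ∈ M, r m) ^ 2 ≤ y * ∑ m ∈ M, r m ^ 2 := by
  refine (sq_sum_le_card_mul_sum_sq (s := M) (f := r)).trans ?_
  have hcard : (M.card : ℝ) ≤ y := by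
    have h1 : M ⊆ Finset.Icc 1 ⌊y⌋₊ := fun m hm => by
      rw [Finset.mem_Icc, Nat.le_floor_iff hy]
      exact hM m hm
    have h2 := Finset.card_le_card h1
    rw [Nat.card_Icc, Nat.add_sub_cancel] at h2
    exact le_trans (by exact_mod_cast h2) (Nat.floor_le hy)
  have := Finset.sum_nonneg fun m (_ : m ∈ M) => sq_nonneg (r m)
  gcongr

theorem norm_resonator_one_le (hr : ∀ m, 0 ≤ r m) :
    ‖∑ m ∈ M, (r m : ℂ) * (1 : DirichletCharacter ℂ q) (m : ZMod q)‖ ≤ ∑ m ∈ M, r m := by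
  refine norm_sum_le_of_le _ fun m _ => ?_
  rw [norm_mul, Complex.norm_real, Real.norm_of_nonneg (hr m)]
  exact mul_le_of_le_one_right (hr m) (DirichletCharacter.norm_le_one _ _)

/-- The resonance inequality for character sums of length `t`, where only the solutions of
`n₁ m₁ = n₂ m₂` are kept. -/
theorem collisionSum_le [NeZero q] {t y : ℝ} (ht : 0 ≤ t) (hy : 0 ≤ y)
    (hM : ∀ m ∈ M, 1 ≤ m ∧ (m : ℝ) ≤ y) (hMq : ∀ m ∈ M, m.Coprime q) (hMlt : ∀ m ∈ M, m < q)
    (hr : ∀ m, 0 ≤ r m) :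
    q.totient * collisionSum t q M r ≤
      (t ^ 2 * y + charSumSup t q ^ 2 * q.totient) * ∑ m ∈ M, r m ^ 2 := by
  have h1 := sum_norm_sq_mul_le (t := t) fun χ : DirichletCharacter ℂ q =>
    ∑ m ∈ M, (r m : ℂ) * χ (m : ZMod q)
  rw [sum_norm_sq_char_sum_mul_resonator t hMq, sum_norm_sq_resonator hMq hMlt, norm_mul,
    mul_pow] at h1
  have h2 : ‖∑ n ∈ Finset.Icc 1 ⌊t⌋₊, (1 : DirichletCharacter ℂ q) (n : ZMod q)‖ ^ 2 *
      ‖∑ m ∈ M, (r m : ℂ) * (1 : DirichletCharacter ℂ q) (m : ZMod q)‖ ^ 2 ≤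
      t ^ 2 * (y * ∑ m ∈ M, r m ^ 2) := by
    have := norm_sum_one_char_le (q := q) t ht
    have := (pow_le_pow_left₀ (norm_nonneg _) (norm_resonator_one_le (q := q) (M := M) hr) 2).trans
      (sq_sum_le_mul_sum_sq hM hy)
    gcongr
  have h3 : collisionSum t q M r ≤ ∑ x ∈ coprimesUpTo t q ×ˢ M, ∑ y ∈ coprimesUpTo t q ×ˢ M,
        (if ((x.1 * x.2 : ℕ) : ZMod q) = ((y.1 * y.2 : ℕ) : ZMod q)
          then r x.2 * r y.2 else 0) := by
    refine Finset.sum_le_sum fun x _ => Finset.sum_le_sum fun y _ => ?_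
    have h0 := mul_nonneg (hr x.2) (hr y.2)
    by_cases h : x.1 * x.2 = y.1 * y.2
    · rw [if_pos h, if_pos (by rw [h])]
    · rw [if_neg h]
      split_ifs
      · exact h0
      · exact le_rfl
  have h4 : (q.totient : ℝ) * collisionSum t q M r ≤ _ :=
    mul_le_mul_of_nonneg_left h3 (Nat.cast_nonneg _)
  linarith

end

theorem prod_one_sub_inv_ge (s : Finset ℕ) (hs : ∀ p ∈ s, 2 ≤ p) :
    1 / ((s.card : ℝ) + 1) ≤ ∏ p ∈ s, (1 - (p : ℝ)⁻¹) := by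
  induction s using Finset.induction_on_max with
  | empty => simp
  | insert a s ha ih =>
    have has : a ∉ s := fun h => lt_irrefl _ (ha a h)
    rw [Finset.prod_insert has, Finset.card_insert_of_notMem has]
    have ih' := ih fun p hp => hs p (Finset.mem_insert_of_mem hp)
    have hcard : s.card + 2 ≤ a := by
      have h1 : s ⊆ Finset.Ico 2 a := fun p hp =>
        Finset.mem_Ico.2 ⟨hs p (Finset.mem_insert_of_mem hp), ha p hp⟩
      have h2 := Finset.card_le_card h1
      rw [Nat.card_Ico] at h2
      have := hs a (Finset.mem_insert_self _ _)
      omega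
    have hcard' : (s.card : ℝ) + 2 ≤ a := by exact_mod_cast hcard
    have hc0 : (0 : ℝ) ≤ s.card := Nat.cast_nonneg _
    have h3 : ((s.card : ℝ) + 1) / (s.card + 2) ≤ 1 - (a : ℝ)⁻¹ := by
      have h4 : (a : ℝ)⁻¹ ≤ ((s.card : ℝ) + 2)⁻¹ := by gcongr
      have h5 : ((s.card : ℝ) + 1) / (s.card + 2) = 1 - ((s.card : ℝ) + 2)⁻¹ := by
        field_simp; ring
      linarith
    push_cast
    calc 1 / ((s.card : ℝ) + 1 + 1)
        = ((s.card : ℝ) + 1) / (s.card + 2) * (1 / (s.card + 1)) := by field_simp; ring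
      _ ≤ _ := by
        have : 0 ≤ ((s.card : ℝ) + 1) / (s.card + 2) := by positivity
        have := this.trans h3
        gcongr

theorem le_totient_mul {q : ℕ} (hq : q ≠ 0) :
    (q : ℝ) ≤ q.totient * (3 * Real.log q + 1) := by
  have h1 := congrArg (fun x : ℚ => (x : ℝ)) (Nat.totient_eq_mul_prod_factors q)
  push_cast at h1
  have h2 := prod_one_sub_inv_ge q.primeFactors fun p hp => (Nat.prime_of_mem_primeFactors hp).two_le
  have h3 := card_primeFactors_le hq
  have h5 : 1 / (3 * Real.log q + 1) ≤ ∏ p ∈ q.primeFactors, (1 - (p : ℝ)⁻¹) :=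
    le_trans (by gcongr) h2
  have h6 : 0 < 3 * Real.log q + 1 := by have := Real.log_natCast_nonneg q; positivity
  rw [h1, mul_assoc]
  apply le_mul_of_one_le_right (Nat.cast_nonneg q)
  rwa [div_le_iff₀ h6] at h5

/-! ### Counting solutions of a congruence -/

/-- The number of solutions of `n₁ m₁ ≡ n₂ m₂ (mod q)` with `1 ≤ n₁, n₂ ≤ X`. -/
def congruenceCount (q X m₁ m₂ : ℕ) : ℕ :=
  ((Finset.Icc 1 X ×ˢ Finset.Icc 1 X).filter fun n =>
    ((n.1 * m₁ : ℕ) : ZMod q) = ((n.2 * m₂ : ℕ) : ZMod q)).card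

theorem congruenceCount_comm (q X m₁ m₂ : ℕ) :
    congruenceCount q X m₁ m₂ = congruenceCount q X m₂ m₁ := by
  refine Finset.card_bij' (fun n _ => n.swap) (fun n _ => n.swap) ?_ ?_ ?_ ?_
  · intro n hn
    simp only [Finset.mem_filter, Finset.mem_product, Prod.fst_swap, Prod.snd_swap] at hn ⊢
    exact ⟨⟨hn.1.2, hn.1.1⟩, hn.2.symm⟩
  · intro n hn
    simp only [Finset.mem_filter, Finset.mem_product, Prod.fst_swap, Prod.snd_swap] at hn ⊢
    exact ⟨⟨hn.1.2, hn.1.1⟩, hn.2.symm⟩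
  · intro n _; rfl
  · intro n _; rfl

/-- The solutions of the equation `n₁ m₁ = n₂ m₂`, for `m₁ = g a` and `m₂ = g b`. -/
theorem div_max_le_congruenceCount (q X g a b : ℕ) (ha : 0 < a) (hb : 0 < b) :
    X / max a b ≤ congruenceCount q X (g * a) (g * b) := by
  have h : (Finset.Icc 1 (X / max a b)).card = X / max a b := by simp
  rw [← h]
  refine Finset.card_le_card_of_injOn (fun k => (b * k, a * k)) ?_ ?_
  · intro k hk
    rw [Finset.mem_coe, Finset.mem_Icc, Nat.le_div_iff_mul_le (lt_max_of_lt_left ha)] at hk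
    have h1 : k * a ≤ k * max a b := Nat.mul_le_mul_left _ (le_max_left _ _)
    have h2 : k * b ≤ k * max a b := Nat.mul_le_mul_left _ (le_max_right _ _)
    rw [Finset.mem_coe, Finset.mem_filter, Finset.mem_product, Finset.mem_Icc, Finset.mem_Icc]
    refine ⟨⟨⟨Nat.mul_pos hb hk.1, ?_⟩, ⟨Nat.mul_pos ha hk.1, ?_⟩⟩, ?_⟩
    · simp only; rw [mul_comm]; omega
    · simp only; rw [mul_comm]; omega
    · congr 1; ring
  · intro k _ l _ hkl
    exact Nat.eq_of_mul_eq_mul_left hb (Prod.ext_iff.1 hkl).1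

/-- Among any `a` consecutive integers one solves `b n + c ≡ 0 (mod a)`, if `a` and `b` are
coprime. -/
theorem exists_dvd_of_isCoprime {a b : ℤ} (ha : 0 < a) (h : IsCoprime b a) (n₀ c : ℤ) :
    ∃ n, n₀ < n ∧ n ≤ n₀ + a ∧ a ∣ b * n + c := by
  obtain ⟨u, v, huv⟩ := h
  set t := (-u * c - n₀ - 1) % a with ht
  have h1 : 0 ≤ t := Int.emod_nonneg _ ha.ne'
  have h2 : t < a := Int.emod_lt_of_pos _ ha
  obtain ⟨w, hw⟩ : ∃ w, -u * c - n₀ - 1 - t = a * w := Int.dvd_self_sub_emod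
  refine ⟨n₀ + 1 + t, by omega, by omega, c * v - b * w, ?_⟩
  have : n₀ + 1 + t = -u * c - a * w := by linarith
  rw [this]
  linear_combination (-c) * huv

/-- A lower bound for the number of solutions of the congruence `a n₁ ≡ b n₂ (mod q)`: in a block of
`a` consecutive values of `n₂`, each `j` gives one solution of `a n₁ = b n₂ + q j`. -/
theorem div_mul_le_congruenceCount {q X g a b : ℕ} (hq : 0 < q) (ha : 0 < a) (hb : 0 < b)
    (hab : a.Coprime b) :
    ((X / a : ℕ) : ℝ) * (((a : ℝ) * X - a * b) / q - 1) ≤ congruenceCount q X (g * a) (g * b) := by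
  set u : ℕ → ℝ := fun i => -((b : ℝ) * (a * i + 1)) / q with hu
  set v : ℕ → ℝ := fun i => ((a : ℝ) * X - b * (a * i + a)) / q with hv
  set Js : ℕ → Finset ℤ := fun i => Finset.Ioc ⌊u i⌋ ⌊v i⌋ with hJs
  have hq0 : (0 : ℝ) < q := by exact_mod_cast hq
  have hb1 : (1 : ℝ) ≤ b := by exact_mod_cast hb
  have hcard : ∀ i, ((a : ℝ) * X - a * b) / q - 1 ≤ ((Js i).card : ℝ) := by
    intro i
    rw [hJs, Int.card_Ioc]
    have h1 : ((⌊v i⌋ - ⌊u i⌋ : ℤ) : ℝ) ≤ (((⌊v i⌋ - ⌊u i⌋).toNat : ℤ) : ℝ) :=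
      Int.cast_le.2 (Int.self_le_toNat _)
    rw [Int.cast_natCast] at h1
    refine le_trans ?_ h1
    push_cast
    have h2 := Int.lt_floor_add_one (v i)
    have h3 := Int.floor_le (u i)
    have h4 : v i - u i = ((a : ℝ) * X - a * b) / q + b / q := by
      simp only [hu, hv]; ring
    have h5 : 0 ≤ (b : ℝ) / q := by positivity
    linarith
  have hcop : IsCoprime (b : ℤ) (a : ℤ) := (Nat.isCoprime_iff_coprime.2 hab).symm
  have hsol : ∀ (i : ℕ) (j : ℤ), ∃ n, ((a * i : ℕ) : ℤ) < n ∧ n ≤ ((a * i : ℕ) : ℤ) + a ∧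
      (a : ℤ) ∣ b * n + q * j := fun i j =>
    exists_dvd_of_isCoprime (by exact_mod_cast ha) hcop _ _
  choose n₂ h2lo h2hi h2dvd using hsol
  choose n₁ hn₁ using h2dvd
  have hrange : ∀ i < X / a, ∀ j ∈ Js i,
      0 < n₁ i j ∧ n₁ i j ≤ X ∧ 0 < n₂ i j ∧ n₂ i j ≤ X := by
    intro i hi j hj
    rw [hJs, Finset.mem_Ioc, Int.floor_lt, Int.le_floor] at hj
    obtain ⟨hj1, hj2⟩ := hj
    simp only [hu, hv] at hj1 hj2
    rw [div_lt_iff₀ hq0] at hj1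
    rw [le_div_iff₀ hq0] at hj2
    have hj1' : -((b : ℤ) * (a * i + 1)) < j * q := by exact_mod_cast hj1
    have hj2' : j * q ≤ (a : ℤ) * X - b * (a * i + a) := by exact_mod_cast hj2
    have e := hn₁ i j
    have lo := h2lo i j
    have hi2 := h2hi i j
    push_cast at lo hi2
    have ha' : (0 : ℤ) < a := by exact_mod_cast ha
    have hb' : (0 : ℤ) < b := by exact_mod_cast hb
    refine ⟨?_, ?_, ?_, ?_⟩
    · have : (b : ℤ) * (a * i + 1) ≤ b * n₂ i j := by gcongr; omega
      have : 0 < (a : ℤ) * n₁ i j := by linarith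
      exact pos_of_mul_pos_right this ha'.le
    · have : (b : ℤ) * n₂ i j ≤ b * (a * i + a) := by gcongr
      have : (a : ℤ) * n₁ i j ≤ a * X := by linarith
      exact le_of_mul_le_mul_left this ha'
    · have : (0 : ℤ) ≤ a * i := by positivity
      omega
    · have h3 : (i + 1) * a ≤ X := by
        rw [← Nat.le_div_iff_mul_le ha]; omega
      have h4 : ((i : ℤ) + 1) * a ≤ X := by exact_mod_cast h3
      linarith
  have hsig : ∑ i ∈ Finset.range (X / a), (Js i).card ≤ congruenceCount q X (g * a) (g * b) := by
    rw [← Finset.card_sigma]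
    refine Finset.card_le_card_of_injOn
      (fun x : (_ : ℕ) × ℤ => ((n₁ x.1 x.2).toNat, (n₂ x.1 x.2).toNat)) ?_ ?_
    · rintro ⟨i, j⟩ hx
      rw [Finset.mem_coe, Finset.mem_sigma, Finset.mem_range] at hx
      obtain ⟨h1, h1', h2, h2'⟩ := hrange i hx.1 j hx.2
      rw [Finset.mem_coe, Finset.mem_filter, Finset.mem_product, Finset.mem_Icc, Finset.mem_Icc]
      refine ⟨⟨⟨by simp only; omega, by simp only; omega⟩,
        ⟨by simp only; omega, by simp only; omega⟩⟩, ?_⟩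
      have e2 : (((n₁ i j).toNat * (g * a) : ℕ) : ℤ) =
          (((n₂ i j).toNat * (g * b) : ℕ) : ℤ) + (q : ℤ) * (j * g) := by
        push_cast
        rw [Int.toNat_of_nonneg h1.le, Int.toNat_of_nonneg h2.le]
        linear_combination (-(g : ℤ)) * hn₁ i j
      have e3 := congrArg (fun z : ℤ => (z : ZMod q)) e2
      simp only [Int.cast_add, Int.cast_natCast, Int.cast_mul (q : ℤ), ZMod.natCast_self, zero_mul,
        add_zero] at e3
      exact e3
    · rintro ⟨i, j⟩ hx ⟨i', j'⟩ hx' h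
      rw [Finset.mem_coe, Finset.mem_sigma, Finset.mem_range] at hx hx'
      obtain ⟨p1, -, p2, -⟩ := hrange i hx.1 j hx.2
      obtain ⟨p1', -, p2', -⟩ := hrange i' hx'.1 j' hx'.2
      have hn1 : n₁ i j = n₁ i' j' := by
        have : (n₁ i j).toNat = (n₁ i' j').toNat := (Prod.ext_iff.1 h).1
        omega
      have hn2 : n₂ i j = n₂ i' j' := by
        have : (n₂ i j).toNat = (n₂ i' j').toNat := (Prod.ext_iff.1 h).2
        omega
      have hii : i = i' := by
        have lo := h2lo i j
        have hi2 := h2hi i j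
        have lo' := h2lo i' j'
        have hi2' := h2hi i' j'
        rw [hn2] at lo hi2
        have k1 : a * i < a * (i' + 1) := by
          have := lo.trans_le hi2'
          rw [mul_add, mul_one]
          exact_mod_cast this
        have k2 : a * i' < a * (i + 1) := by
          have := lo'.trans_le hi2
          rw [mul_add, mul_one]
          exact_mod_cast this
        have k3 := Nat.lt_of_mul_lt_mul_left k1
        have k4 := Nat.lt_of_mul_lt_mul_left k2
        omega
      have hjj : j = j' := by
        have e := hn₁ i j
        have e' := hn₁ i' j'
        rw [hn1, hn2] at e
        have hq' : (q : ℤ) ≠ 0 := by exact_mod_cast hq.ne'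
        apply mul_left_cancel₀ hq'
        linarith
      rw [hii, hjj]
  have hmain : ((X / a : ℕ) : ℝ) * (((a : ℝ) * X - a * b) / q - 1) ≤
      ∑ i ∈ Finset.range (X / a), ((Js i).card : ℝ) := by
    rw [← nsmul_eq_mul, ← Finset.card_range (X / a), ← Finset.sum_const, Finset.card_range]
    exact Finset.sum_le_sum fun i _ => hcard i
  exact hmain.trans (by exact_mod_cast hsig)

theorem congruenceCount_ge_of_le {q X g a b : ℕ} (hq : 0 < q) (ha : 0 < a) (hb : 0 < b)
    (hab : a.Coprime b) (hba : b ≤ a) :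
    (X : ℝ) ^ 2 / q - 2 * X * a / q - 2 * X / a ≤ congruenceCount q X (g * a) (g * b) := by
  have h := div_mul_le_congruenceCount (X := X) (g := g) hq ha hb hab
  have hq0 : (0 : ℝ) < q := by exact_mod_cast hq
  have ha0 : (0 : ℝ) < a := by exact_mod_cast ha
  have hb0 : (0 : ℝ) < b := by exact_mod_cast hb
  have hba' : (b : ℝ) ≤ a := by exact_mod_cast hba
  have hX : (0 : ℝ) ≤ X := Nat.cast_nonneg _
  have h1 : (X : ℝ) * b / q ≤ X * a / q := by gcongr
  have h2 : 0 ≤ (X : ℝ) / a := by positivity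
  have h3 : 0 ≤ (X : ℝ) * b / q := by positivity
  have h4 : 0 ≤ (a : ℝ) * b / q := by positivity
  set E := ((a : ℝ) * X - a * b) / q - 1 with hE
  rcases le_or_gt 0 E with hE0 | hE0
  · refine le_trans ?_ h
    have h5 : (X : ℝ) / a - 1 ≤ ((X / a : ℕ) : ℝ) := by
      have h6 : X < (X / a + 1) * a := by
        rw [add_mul, one_mul]; exact Nat.lt_div_mul_add ha
      have h7 : (X : ℝ) < (((X / a : ℕ) : ℝ) + 1) * a := by exact_mod_cast h6
      rw [← div_lt_iff₀ ha0] at h7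
      linarith
    refine le_trans ?_ (mul_le_mul_of_nonneg_right h5 hE0)
    have h8 : ((X : ℝ) / a - 1) * E =
        (X : ℝ) ^ 2 / q - X * b / q - X / a - X * a / q + a * b / q + 1 := by
      rw [hE]; field_simp; ring
    rw [h8]
    have e1 : 2 * (X : ℝ) * a / q = 2 * (X * a / q) := by ring
    have e2 : 2 * (X : ℝ) / a = 2 * (X / a) := by ring
    rw [e1, e2]
    linarith
  · refine le_trans ?_ (Nat.cast_nonneg _)
    have h5 : (X : ℝ) / a * E ≤ 0 := mul_nonpos_of_nonneg_of_nonpos h2 hE0.le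
    have h6 : (X : ℝ) / a * E = (X : ℝ) ^ 2 / q - X * b / q - X / a := by
      rw [hE]; field_simp
    have e1 : 2 * (X : ℝ) * a / q = 2 * (X * a / q) := by ring
    have e2 : 2 * (X : ℝ) / a = 2 * (X / a) := by ring
    rw [e1, e2]
    linarith

/-- The number of solutions of `n₁ m₁ ≡ n₂ m₂ (mod q)` falls short of the expected `X² / q` by
little. -/
theorem congruenceCount_ge {q X m₁ m₂ : ℕ} (hq : 0 < q) (h1 : 0 < m₁) (h2 : 0 < m₂) :
    (X : ℝ) ^ 2 / q - 2 * X * ((max m₁ m₂ / m₁.gcd m₂ : ℕ) : ℝ) / q -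
      2 * X / ((max m₁ m₂ / m₁.gcd m₂ : ℕ) : ℝ) ≤ congruenceCount q X m₁ m₂ := by
  wlog h : m₂ ≤ m₁ generalizing m₁ m₂
  · rw [congruenceCount_comm, max_comm, Nat.gcd_comm]
    exact this h2 h1 (le_of_not_ge h)
  have hg : 0 < m₁.gcd m₂ := Nat.gcd_pos_of_pos_left _ h1
  have e1 : m₁.gcd m₂ * (m₁ / m₁.gcd m₂) = m₁ := Nat.mul_div_cancel' (Nat.gcd_dvd_left _ _)
  have e2 : m₁.gcd m₂ * (m₂ / m₁.gcd m₂) = m₂ := Nat.mul_div_cancel' (Nat.gcd_dvd_right _ _)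
  rw [max_eq_left h]
  have := congruenceCount_ge_of_le (X := X) (g := m₁.gcd m₂) hq
    (Nat.div_pos (Nat.le_of_dvd h1 (Nat.gcd_dvd_left _ _)) hg)
    (Nat.div_pos (Nat.le_of_dvd h2 (Nat.gcd_dvd_right _ _)) hg)
    (Nat.coprime_div_gcd_div_gcd hg) (Nat.div_le_div_right h)
  rwa [e1, e2] at this

theorem div_quotient_le_congruenceCount {q X m₁ m₂ : ℕ} (h1 : 0 < m₁) (h2 : 0 < m₂) :
    X / (max m₁ m₂ / m₁.gcd m₂) ≤ congruenceCount q X m₁ m₂ := by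
  have hg : 0 < m₁.gcd m₂ := Nat.gcd_pos_of_pos_left _ h1
  have e1 : m₁.gcd m₂ * (m₁ / m₁.gcd m₂) = m₁ := Nat.mul_div_cancel' (Nat.gcd_dvd_left _ _)
  have e2 : m₁.gcd m₂ * (m₂ / m₁.gcd m₂) = m₂ := Nat.mul_div_cancel' (Nat.gcd_dvd_right _ _)
  have := div_max_le_congruenceCount q X (m₁.gcd m₂) (m₁ / m₁.gcd m₂) (m₂ / m₁.gcd m₂)
    (Nat.div_pos (Nat.le_of_dvd h1 (Nat.gcd_dvd_left _ _)) hg)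
    (Nat.div_pos (Nat.le_of_dvd h2 (Nat.gcd_dvd_right _ _)) hg)
  rw [e1, e2] at this
  have hm : max (m₁ / m₁.gcd m₂) (m₂ / m₁.gcd m₂) = max m₁ m₂ / m₁.gcd m₂ :=
    
    (Monotone.map_max (f := fun k => k / m₁.gcd m₂) fun _ _ h => Nat.div_le_div_right h).symm
  rwa [hm] at this

/-- The equation `n₁ m₁ = n₂ m₂` has at most `W / A` solutions with `n₁, n₂ ≤ W`, where `A` is the
larger of the quotients of `m₁` and `m₂` by their greatest common divisor. -/
theorem card_collisions_le {W : ℝ} (hW : 0 ≤ W) {q m₁ m₂ : ℕ} (h1 : 0 < m₁) (h2 : 0 < m₂) :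
    (((coprimesUpTo W q ×ˢ coprimesUpTo W q).filter fun n => n.1 * m₁ = n.2 * m₂).card : ℝ) ≤
      (⌊W / ((max m₁ m₂ / m₁.gcd m₂ : ℕ) : ℝ)⌋₊ : ℝ) := by
  have hg : 0 < m₁.gcd m₂ := Nat.gcd_pos_of_pos_left _ h1
  set g := m₁.gcd m₂ with hgdef
  obtain ⟨a, ha⟩ : g ∣ m₁ := Nat.gcd_dvd_left _ _
  obtain ⟨b, hb⟩ : g ∣ m₂ := Nat.gcd_dvd_right _ _
  have ha0 : 0 < a := Nat.pos_of_ne_zero (by rintro rfl; simp at ha; omega)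
  have hb0 : 0 < b := Nat.pos_of_ne_zero (by rintro rfl; simp at hb; omega)
  have hab : b.Coprime a := by
    have := Nat.coprime_div_gcd_div_gcd (m := m₁) (n := m₂) hg
    rw [← hgdef] at this
    rw [ha, hb, Nat.mul_div_cancel_left _ hg, Nat.mul_div_cancel_left _ hg] at this
    exact this.symm
  have hmax : max m₁ m₂ / g = max a b := by
    rw [ha, hb, Nat.mul_max_mul_left, Nat.mul_div_cancel_left _ hg]
  rw [hmax]
  have hA0 : (0 : ℝ) < ((max a b : ℕ) : ℝ) := by exact_mod_cast lt_max_of_lt_left ha0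
  have hcard : (Finset.Icc 1 ⌊W / ((max a b : ℕ) : ℝ)⌋₊).card = ⌊W / ((max a b : ℕ) : ℝ)⌋₊ := by
    simp
  rw [Nat.cast_le, ← hcard]
  have hform : ∀ n ∈ (coprimesUpTo W q ×ˢ coprimesUpTo W q).filter
      (fun n => n.1 * m₁ = n.2 * m₂), n.1 = b * (n.1 / b) ∧ n.2 = a * (n.1 / b) := by
    intro n hn
    have h3 := (Finset.mem_filter.1 hn).2
    rw [ha, hb] at h3
    have h4 : n.1 * a = n.2 * b := Nat.eq_of_mul_eq_mul_left hg (by linarith)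
    obtain ⟨k, hk⟩ : b ∣ n.1 := hab.dvd_of_dvd_mul_right (Dvd.intro_left _ h4.symm)
    rw [hk, Nat.mul_div_cancel_left _ hb0]
    refine ⟨rfl, Nat.eq_of_mul_eq_mul_right hb0 ?_⟩
    rw [← h4, hk]; ring
  refine Finset.card_le_card_of_injOn (fun n => n.1 / b) ?_ ?_
  · intro n hn
    obtain ⟨e1, e2⟩ := hform n hn
    rw [Finset.mem_coe, Finset.mem_filter, Finset.mem_product, mem_coprimesUpTo hW,
      mem_coprimesUpTo hW] at hn
    set k := n.1 / b with hk
    have hk0 : k ≠ 0 := by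
      intro h
      rw [h, mul_zero] at e1
      omega
    rw [Finset.mem_coe, Finset.mem_Icc, Nat.le_floor_iff (by positivity), le_div_iff₀ hA0]
    refine ⟨Nat.one_le_iff_ne_zero.2 hk0, ?_⟩
    rcases le_total a b with h | h
    · rw [max_eq_right h]
      calc (k : ℝ) * b = ((b * k : ℕ) : ℝ) := by push_cast; ring
        _ ≤ W := by rw [← e1]; exact hn.1.1.2.1
    · rw [max_eq_left h]
      calc (k : ℝ) * a = ((a * k : ℕ) : ℝ) := by push_cast; ring
        _ ≤ W := by rw [← e2]; exact hn.1.2.2.1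
  · intro n hn n' hn' h
    obtain ⟨e1, e2⟩ := hform n hn
    obtain ⟨e1', e2'⟩ := hform n' hn'
    simp only at h
    rw [← h] at e1' e2'
    exact Prod.ext (e1.trans e1'.symm) (e2.trans e2'.symm)

/-! ### The resonance inequality for prime moduli -/

theorem sum_product_ite_eq_sum_mul_card (I M : Finset ℕ) (r : ℕ → ℝ) (p : ℕ × ℕ → ℕ × ℕ → Prop)
    [∀ x y, Decidable (p x y)] :
    ∑ x ∈ I ×ˢ M, ∑ y ∈ I ×ˢ M, (if p x y then r x.2 * r y.2 else 0) =
      ∑ m ∈ M, ∑ n ∈ M, r m * r n *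
        (((I ×ˢ I).filter fun k => p (k.1, m) (k.2, n)).card : ℝ) := by
  rw [Finset.sum_product_right]
  refine Finset.sum_congr rfl fun m _ => ?_
  simp only [Finset.sum_product_right (s := I) (t := M)]
  rw [Finset.sum_comm]
  refine Finset.sum_congr rfl fun n _ => ?_
  rw [← Finset.sum_product', ← Finset.sum_filter, Finset.sum_const, nsmul_eq_mul, mul_comm]

theorem collisionSum_le_sum_floor {W : ℝ} (hW : 0 ≤ W) {q : ℕ} {M : Finset ℕ} {r : ℕ → ℝ}
    (hM : ∀ m ∈ M, 1 ≤ m) (hr : ∀ m, 0 ≤ r m) :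
    collisionSum W q M r ≤ ∑ m ∈ M, ∑ n ∈ M, r m * r n *
      (⌊W / ((max m n / m.gcd n : ℕ) : ℝ)⌋₊ : ℝ) := by
  rw [collisionSum, sum_product_ite_eq_sum_mul_card]
  refine Finset.sum_le_sum fun m hm => Finset.sum_le_sum fun n hn => ?_
  exact mul_le_mul_of_nonneg_left (card_collisions_le hW (hM m hm) (hM n hn))
    (mul_nonneg (hr m) (hr n))

theorem coprimesUpTo_of_prime {q : ℕ} (hq : q.Prime) {t : ℝ} (ht : ⌊t⌋₊ < q) :
    coprimesUpTo t q = Finset.Icc 1 ⌊t⌋₊ := by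
  refine Finset.filter_true_of_mem fun n hn => ?_
  rw [Finset.mem_Icc] at hn
  exact (Nat.coprime_of_lt_prime (by omega) (by omega) hq).symm

/-- The resonance inequality for a prime modulus: the second moment over the non-principal
characters is the excess of the congruence counts over their expectation. -/
theorem sum_congruenceCount_sub_le {q : ℕ} (hq : q.Prime) {t : ℝ} {M : Finset ℕ} {r : ℕ → ℝ}
    (hX : ⌊t⌋₊ < q) (hM : ∀ m ∈ M, 1 ≤ m ∧ m < q) (hr : ∀ m, 0 ≤ r m) :
    ∑ m ∈ M, ∑ n ∈ M, r m * r n *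
        ((congruenceCount q ⌊t⌋₊ m n : ℝ) - (⌊t⌋₊ : ℝ) ^ 2 / ((q : ℝ) - 1)) ≤
      charSumSup t q ^ 2 * ∑ m ∈ M, r m ^ 2 := by
  have : NeZero q := ⟨hq.ne_zero⟩
  have hMq : ∀ m ∈ M, m.Coprime q := fun m hm =>
    (Nat.coprime_of_lt_prime (Nat.one_le_iff_ne_zero.1 (hM m hm).1) (hM m hm).2 hq).symm
  have hφ : (q.totient : ℝ) = (q : ℝ) - 1 := by
    rw [Nat.totient_prime hq, Nat.cast_sub hq.one_le, Nat.cast_one]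
  have hφ0 : 0 < (q : ℝ) - 1 := by
    have : (1 : ℝ) < q := by exact_mod_cast hq.one_lt
    linarith
  have h1 := sum_norm_sq_mul_le (t := t) fun χ : DirichletCharacter ℂ q =>
    ∑ m ∈ M, (r m : ℂ) * χ (m : ZMod q)
  rw [sum_norm_sq_char_sum_mul_resonator t hMq,
    sum_norm_sq_resonator hMq fun m hm => (hM m hm).2, coprimesUpTo_of_prime hq hX,
    sum_product_ite_eq_sum_mul_card, norm_mul, mul_pow, hφ] at h1
  have h2 : ‖∑ n ∈ Finset.Icc 1 ⌊t⌋₊, (1 : DirichletCharacter ℂ q) (n : ZMod q)‖ ^ 2 *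
      ‖∑ m ∈ M, (r m : ℂ) * (1 : DirichletCharacter ℂ q) (m : ZMod q)‖ ^ 2 ≤
      (⌊t⌋₊ : ℝ) ^ 2 * (∑ m ∈ M, r m) ^ 2 := by
    have h3 := norm_sum_one_char_le (q := q) (⌊t⌋₊ : ℝ) (Nat.cast_nonneg _)
    rw [Nat.floor_natCast] at h3
    have := norm_resonator_one_le (q := q) (M := M) hr
    gcongr
  have h3 : ∑ m ∈ M, ∑ n ∈ M, r m * r n *
        ((congruenceCount q ⌊t⌋₊ m n : ℝ) - (⌊t⌋₊ : ℝ) ^ 2 / ((q : ℝ) - 1)) =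
      ∑ m ∈ M, ∑ n ∈ M, r m * r n * (congruenceCount q ⌊t⌋₊ m n : ℝ) -
        (⌊t⌋₊ : ℝ) ^ 2 * (∑ m ∈ M, r m) ^ 2 / ((q : ℝ) - 1) := by
    rw [sq (∑ m ∈ M, r m), Finset.sum_mul_sum, mul_comm ((⌊t⌋₊ : ℝ) ^ 2), mul_div_assoc,
      Finset.sum_mul, ← Finset.sum_sub_distrib]
    refine Finset.sum_congr rfl fun m _ => ?_
    rw [Finset.sum_mul, ← Finset.sum_sub_distrib]
    exact Finset.sum_congr rfl fun n _ => by ring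
  rw [h3, sub_le_iff_le_add]
  have h4 : ((q : ℝ) - 1) * ∑ m ∈ M, ∑ n ∈ M, r m * r n * (congruenceCount q ⌊t⌋₊ m n : ℝ) ≤
      (⌊t⌋₊ : ℝ) ^ 2 * (∑ m ∈ M, r m) ^ 2 +
        charSumSup t q ^ 2 * (((q : ℝ) - 1) * ∑ m ∈ M, r m ^ 2) :=
    h1.trans (by linarith)
  rw [mul_comm, ← le_div_iff₀ hφ0] at h4
  refine h4.trans (le_of_eq ?_)
  field_simp
  ring

/-- The excess of a congruence count over its expectation is bounded below by the number of
solutions of the equation if the quotients are at most `N / 8`, and by a small negative quantity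
otherwise. -/
theorem congruenceCount_sub_ge {q X m n : ℕ} {N y : ℝ} (hm : 1 ≤ m) (hn : 1 ≤ n)
    (hmy : (m : ℝ) ≤ y) (hny : (n : ℝ) ≤ y) (hN : 0 < N) (hXq : X < q) (hXN : X * N ≤ q)
    (hyX : y ≤ X) :
    (X : ℝ) / (4 * (N / 8)) * (⌊N / 8 / ((max m n / m.gcd n : ℕ) : ℝ)⌋₊ : ℝ)
      - 2 * X * (if N / 8 < ((max m n / m.gcd n : ℕ) : ℝ)
          then 1 / ((max m n / m.gcd n : ℕ) : ℝ) else 0) - (2 * X * y / q + 1) ≤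
      (congruenceCount q X m n : ℝ) - (X : ℝ) ^ 2 / ((q : ℝ) - 1) := by
  have hlow := div_quotient_le_congruenceCount (q := q) (X := X) hm hn
  have hgen := congruenceCount_ge (q := q) (X := X) (by omega) hm hn
  have hg : 0 < m.gcd n := Nat.gcd_pos_of_pos_left _ hm
  set A := max m n / m.gcd n with hA
  have hA0 : 0 < A := Nat.div_pos (le_trans (Nat.le_of_dvd hm (Nat.gcd_dvd_left m n))
    (le_max_left _ _)) hg
  have hA0' : (0 : ℝ) < A := by exact_mod_cast hA0
  have hAy : (A : ℝ) ≤ y := by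
    have h1 : A ≤ max m n := Nat.div_le_self _ _
    have h2 : (A : ℝ) ≤ max (m : ℝ) n := by exact_mod_cast h1
    exact h2.trans (max_le hmy hny)
  have hAX : A ≤ X := by exact_mod_cast hAy.trans hyX
  have hX1 : 1 ≤ X := le_trans hA0 hAX
  have hX0 : (0 : ℝ) < X := by exact_mod_cast hX1
  have hq2 : (2 : ℝ) ≤ q := by exact_mod_cast (by omega : 2 ≤ q)
  have hXq' : (X : ℝ) ≤ (q : ℝ) - 1 := by
    have : ((X + 1 : ℕ) : ℝ) ≤ q := by exact_mod_cast hXq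
    push_cast at this; linarith
  have hq0 : (0 : ℝ) < q := by linarith
  have hq1 : (0 : ℝ) < (q : ℝ) - 1 := by linarith
  have hy0 : 0 ≤ y := hA0'.le.trans hAy
  split_ifs with h
  · have hfloor : ⌊N / 8 / (A : ℝ)⌋₊ = 0 := by
      rw [Nat.floor_eq_zero, div_lt_one hA0']; exact h
    rw [hfloor, Nat.cast_zero, mul_zero]
    have h1 : (X : ℝ) ^ 2 / ((q : ℝ) - 1) ≤ (X : ℝ) ^ 2 / q + 1 := by
      have : (X : ℝ) ^ 2 / ((q : ℝ) - 1) - (X : ℝ) ^ 2 / q = (X : ℝ) ^ 2 / (((q : ℝ) - 1) * q) := by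
        field_simp; ring
      have h2 : (X : ℝ) ^ 2 / (((q : ℝ) - 1) * q) ≤ 1 := by
        rw [div_le_one (by positivity), sq]
        apply mul_le_mul hXq' (by linarith) hX0.le hq1.le
      linarith
    have h2 : 2 * (X : ℝ) * A / q ≤ 2 * X * y / q := by gcongr
    have h3 : 2 * (X : ℝ) * (1 / A) = 2 * X / A := by ring
    rw [h3]
    linarith
  · rw [not_lt] at h
    have h1 : (X : ℝ) / (2 * A) ≤ congruenceCount q X m n := by
      have h2 : ((X / A : ℕ) : ℝ) ≤ congruenceCount q X m n := by exact_mod_cast hlow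
      refine le_trans ?_ h2
      have h3 : X < (X / A + 1) * A := by
        rw [add_mul, one_mul]; exact Nat.lt_div_mul_add hA0
      have h4 : 1 ≤ X / A := (Nat.one_le_div_iff hA0).2 hAX
      have h5 : X ≤ 2 * (X / A) * A := by nlinarith
      have h6 : (X : ℝ) ≤ 2 * ((X / A : ℕ) : ℝ) * A := by exact_mod_cast h5
      rw [div_le_iff₀ (by positivity)]
      linarith
    have h2 : (X : ℝ) ^ 2 / ((q : ℝ) - 1) ≤ X / (4 * A) := by
      rw [div_le_div_iff₀ hq1 (by positivity)]
      have h3 : (X : ℝ) * (4 * A) ≤ q / 2 := by nlinarith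
      calc (X : ℝ) ^ 2 * (4 * A) = X * (X * (4 * A)) := by ring
        _ ≤ X * (q / 2) := by gcongr
        _ ≤ X * ((q : ℝ) - 1) := by gcongr; linarith
    have h3 : (X : ℝ) / (4 * (N / 8)) * (⌊N / 8 / (A : ℝ)⌋₊ : ℝ) ≤ X / (4 * A) := by
      have h4 := Nat.floor_le (show 0 ≤ N / 8 / (A : ℝ) by positivity)
      calc (X : ℝ) / (4 * (N / 8)) * (⌊N / 8 / (A : ℝ)⌋₊ : ℝ)
          ≤ (X : ℝ) / (4 * (N / 8)) * (N / 8 / (A : ℝ)) := by gcongr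
        _ = X / (4 * A) := by field_simp
    have h4 : (X : ℝ) / (2 * A) = X / (4 * A) + X / (4 * A) := by field_simp; ring
    have h5 : 0 ≤ 2 * (X : ℝ) * y / q := by positivity
    rw [mul_zero]
    linarith

/-- The resonance inequality for character sums of length `q / N` to a prime modulus `q`. -/
theorem collisionSum_le_of_prime {q : ℕ} (hq : q.Prime) {N y V : ℝ} {M : Finset ℕ} {r : ℕ → ℝ}
    (hN : 1 < N) (hy : y ^ 2 ≤ q / N) (hy0 : 0 ≤ y) (hyX : y ≤ ⌊(q : ℝ) / N⌋₊)
    (hM : ∀ m ∈ M, 1 ≤ m ∧ (m : ℝ) ≤ y) (hr : ∀ m, 0 ≤ r m)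
    (hV : ∑ m ∈ M, ∑ n ∈ M, (if N / 8 < ((max m n / m.gcd n : ℕ) : ℝ) then
          r m * r n / ((max m n / m.gcd n : ℕ) : ℝ) else 0) ≤ V) :
    (⌊(q : ℝ) / N⌋₊ : ℝ) / (4 * (N / 8)) * collisionSum (N / 8) q M r ≤
      (charSumSup ((q : ℝ) / N) q ^ 2 + 3 * ⌊(q : ℝ) / N⌋₊) * ∑ m ∈ M, r m ^ 2 +
        2 * ⌊(q : ℝ) / N⌋₊ * V := by
  set t := (q : ℝ) / N with ht
  set X := ⌊t⌋₊ with hX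
  have hN0 : 0 < N := by linarith
  have hq0 : (0 : ℝ) < q := by exact_mod_cast hq.pos
  have ht0 : 0 ≤ t := by positivity
  have htq : t < q := div_lt_self hq0 hN
  have hXt : (X : ℝ) ≤ t := Nat.floor_le ht0
  have hXq : X < q := by exact_mod_cast hXt.trans_lt htq
  have hXN : X * N ≤ q := by rwa [ht, le_div_iff₀ hN0] at hXt
  have hMq : ∀ m ∈ M, 1 ≤ m ∧ m < q := fun m hm => by
    refine ⟨(hM m hm).1, ?_⟩
    have := (hM m hm).2.trans (hyX.trans hXt)
    exact_mod_cast this.trans_lt htq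
  have hmain := sum_congruenceCount_sub_le hq (t := t) hXq hMq hr
  have hcol := collisionSum_le_sum_floor (W := N / 8) (q := q) (by positivity)
    (fun m hm => (hM m hm).1) hr
  have hlower : (X : ℝ) / (4 * (N / 8)) * (∑ m ∈ M, ∑ n ∈ M, r m * r n *
      (⌊N / 8 / ((max m n / m.gcd n : ℕ) : ℝ)⌋₊ : ℝ)) -
      2 * X * (∑ m ∈ M, ∑ n ∈ M, (if N / 8 < ((max m n / m.gcd n : ℕ) : ℝ) then
          r m * r n / ((max m n / m.gcd n : ℕ) : ℝ) else 0)) -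
      (2 * X * y / q + 1) * (∑ m ∈ M, r m) ^ 2 ≤
      ∑ m ∈ M, ∑ n ∈ M, r m * r n *
        ((congruenceCount q X m n : ℝ) - (X : ℝ) ^ 2 / ((q : ℝ) - 1)) := by
    rw [sq, Finset.sum_mul_sum]
    simp only [Finset.mul_sum, ← Finset.sum_sub_distrib]
    refine Finset.sum_le_sum fun m hm => Finset.sum_le_sum fun n hn => ?_
    have h := mul_le_mul_of_nonneg_left (congruenceCount_sub_ge (hM m hm).1 (hM n hn).1
      (hM m hm).2 (hM n hn).2 hN0 hXq hXN hyX) (mul_nonneg (hr m) (hr n))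
    refine le_trans (le_of_eq ?_) h
    split_ifs <;> ring
  have hsum := sq_sum_le_mul_sum_sq (r := r) hM hy0
  set ρ := ∑ m ∈ M, r m ^ 2 with hρ
  have hρ0 : 0 ≤ ρ := Finset.sum_nonneg fun m _ => sq_nonneg _
  have herr : (2 * X * y / q + 1) * (∑ m ∈ M, r m) ^ 2 ≤ 3 * X * ρ := by
    have h1 : (2 * X * y / q + 1) * y ≤ 3 * X := by
      have h2 : 2 * (X : ℝ) * y / q * y = 2 * X * (y ^ 2 / q) := by ring
      have h3 : y ^ 2 / q ≤ 1 := by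
        rw [div_le_one hq0]; exact hy.trans htq.le
      have h4 : 2 * (X : ℝ) * (y ^ 2 / q) ≤ 2 * X * 1 := by gcongr
      rw [add_mul, h2, one_mul]
      linarith
    calc _ ≤ (2 * X * y / q + 1) * (y * ρ) := by gcongr
      _ = (2 * X * y / q + 1) * y * ρ := by ring
      _ ≤ _ := by gcongr
  have h5 : (X : ℝ) / (4 * (N / 8)) * collisionSum (N / 8) q M r ≤ (X : ℝ) / (4 * (N / 8)) * _ :=
    mul_le_mul_of_nonneg_left hcol (by positivity)
  have h6 := mul_le_mul_of_nonneg_left hV (show 0 ≤ 2 * (X : ℝ) by positivity)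
  linarith

/-! ### Lower bounds for the maximal character sum -/

/-- The bound for sums of length `N`, from a resonator of length `q / N`. -/
theorem le_charSumSup_sq {q : ℕ} (hq0 : q ≠ 0) {N V E : ℝ} {M : Finset ℕ} {r : ℕ → ℝ}
    (hN : 1 < N) (hM : ∀ m ∈ M, 1 ≤ m ∧ (m : ℝ) ≤ q / N ∧ m.Coprime q) (hr : ∀ m, 0 ≤ r m)
    (hρ0 : 0 < ∑ m ∈ M, r m ^ 2) (hρV : ∑ m ∈ M, r m ^ 2 ≤ V) (hE : 0 ≤ E)
    (hcol : V * N * E ≤ collisionSum N q M r) :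
    N * (E - (3 * Real.log q + 1)) ≤ charSumSup N q ^ 2 := by
  have : NeZero q := ⟨hq0⟩
  have hN0 : 0 < N := by linarith
  have hq : (0 : ℝ) < q := by exact_mod_cast Nat.pos_of_ne_zero hq0
  have htot := le_totient_mul hq0
  have h1 := collisionSum_le (q := q) (M := M) (r := r) hN0.le (y := q / N) (by positivity)
    (fun m hm => ⟨(hM m hm).1, (hM m hm).2.1⟩) (fun m hm => (hM m hm).2.2) (fun m hm => by
      have := (hM m hm).2.1.trans_lt (div_lt_self hq hN)
      exact_mod_cast this) hr
  set ρ := ∑ m ∈ M, r m ^ 2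
  set φ : ℝ := (q.totient : ℝ)
  have hφ0 : 0 < φ := by
    have : 0 < q.totient := Nat.totient_pos.2 (Nat.pos_of_ne_zero hq0)
    exact Nat.cast_pos.2 this
  have h2 : φ * (ρ * N * E) ≤ (N ^ 2 * (q / N) + charSumSup N q ^ 2 * φ) * ρ := by
    refine le_trans ?_ h1
    refine mul_le_mul_of_nonneg_left (le_trans ?_ hcol) hφ0.le
    gcongr
  have h3 : N ^ 2 * (q / N) = N * q := by field_simp
  rw [h3] at h2
  have h4 : φ * (N * E) ≤ N * q + charSumSup N q ^ 2 * φ := by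
    refine le_of_mul_le_mul_right ?_ hρ0
    linarith
  have h5 : N * q ≤ N * (φ * (3 * Real.log q + 1)) := by gcongr
  refine le_of_mul_le_mul_left ?_ hφ0
  linarith

/-- The bound for sums of length `q / N` to a prime modulus, from a resonator of length
`√(q / N)`. -/
theorem le_charSumSup_div_sq {q : ℕ} (hq : q.Prime) {N V E : ℝ} {M : Finset ℕ} {r : ℕ → ℝ}
    (hN : 1 < N) (ht : 4 ≤ q / N) (hM : ∀ m ∈ M, 1 ≤ m ∧ (m : ℝ) ≤ √(q / N)) (hr : ∀ m, 0 ≤ r m)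
    (hρ0 : 0 < ∑ m ∈ M, r m ^ 2) (hρV : ∑ m ∈ M, r m ^ 2 ≤ V) (hE : 20 ≤ E)
    (hcol : V * (N / 8) * E ≤ collisionSum (N / 8) q M r)
    (hV : ∑ m ∈ M, ∑ n ∈ M, (if N / 8 < ((max m n / m.gcd n : ℕ) : ℝ) then
          r m * r n / ((max m n / m.gcd n : ℕ) : ℝ) else 0) ≤ V) :
    q / N * ((E - 20) / 8) ≤ charSumSup (q / N) q ^ 2 := by
  have hN0 : 0 < N := by linarith
  set t := (q : ℝ) / N with htdef
  have hfl := Nat.lt_floor_add_one t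
  have hst : √t ^ 2 = t := Real.sq_sqrt (by linarith)
  have hs2 : 2 ≤ √t := Real.le_sqrt_of_sq_le (by linarith)
  have hyX : √t ≤ (⌊t⌋₊ : ℝ) := by nlinarith
  have hXt : t / 2 ≤ (⌊t⌋₊ : ℝ) := by linarith
  have h1 := collisionSum_le_of_prime hq hN (y := √t) hst.le (Real.sqrt_nonneg _) hyX hM hr hV
  rw [← htdef] at h1
  set X : ℝ := (⌊t⌋₊ : ℝ)
  set ρ := ∑ m ∈ M, r m ^ 2
  have hX0 : 0 < X := by linarith
  have hV0 : 0 < V := hρ0.trans_le hρV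
  have h2 : X * V * (E / 4) ≤ (charSumSup t q ^ 2 + 3 * X) * V + 2 * X * V := by
    calc X * V * (E / 4) = X / (4 * (N / 8)) * (V * (N / 8) * E) := by field_simp
      _ ≤ X / (4 * (N / 8)) * collisionSum (N / 8) q M r := by gcongr
      _ ≤ _ := h1
      _ ≤ _ := by gcongr
  have h3 : X * (E / 4) ≤ charSumSup t q ^ 2 + 5 * X := by
    refine le_of_mul_le_mul_right ?_ hV0
    linarith
  calc t * ((E - 20) / 8) = t / 2 * ((E - 20) / 4) := by ring
    _ ≤ X * ((E - 20) / 4) := by gcongr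
    _ ≤ _ := by linarith

open Filter in
/-- The exponential gain of the resonator absorbs any constant multiple of `log q`. -/
theorem eventually_le_exp_mul_sqrt {ε δ : ℝ} (hε : 0 < ε) (hδ : 0 < δ) :
    ∀ᶠ q : ℕ in atTop, ∀ Y : ℝ, ε * Real.log q ≤ Y →
      4 * Real.log q ≤ Real.exp (δ * √(Y / Real.log (Real.log q))) := by
  filter_upwards [tendsto_log_natCast.eventually
    (eventually_log_conditions (max 2 (3 / (δ * √ε))))] with q hq Y hY
  set x := Real.log q
  set ℓ := Real.log x
  obtain ⟨h1, h2, -, h4⟩ := hq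
  have hx2 : 2 ≤ x := (le_max_left _ _).trans h1
  have hℓ2 : 2 ≤ ℓ := (le_max_left _ _).trans h2
  have hx0 : 0 < x := by linarith
  have hℓ0 : 0 < ℓ := by linarith
  have hε0 : 0 < √ε := Real.sqrt_pos.2 hε
  rw [← Real.log_le_iff_le_exp (by positivity), Real.log_mul (by norm_num) hx0.ne']
  have hl4 : Real.log 4 ≤ ℓ := by
    rw [show (4 : ℝ) = 2 ^ 2 by norm_num, Real.log_pow]
    have := Real.log_two_lt_d9
    push_cast
    linarith
  have h5 : 3 / (δ * √ε) * ℓ ≤ √(x / ℓ) := le_trans (by gcongr; exact le_max_right _ _) h4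
  rw [div_mul_eq_mul_div, div_le_iff₀ (by positivity)] at h5
  have h6 : √ε * √(x / ℓ) ≤ √(Y / ℓ) := by
    rw [← Real.sqrt_mul hε.le]
    apply Real.sqrt_le_sqrt
    rw [← mul_div_assoc]
    gcongr
  have h7 := mul_le_mul_of_nonneg_left h6 hδ.le
  linarith

theorem sqrt_mul_exp_le {a b c D : ℝ} (ha : 0 ≤ a) (hD : 0 ≤ D) (hbc : b ≤ c)
    (h : a * Real.exp (2 * c) ≤ D ^ 2) : √a * Real.exp b ≤ D := by
  refine (sq_le_sq₀ (by positivity) hD).1 (le_trans ?_ h)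
  rw [mul_pow, Real.sq_sqrt ha, ← Real.exp_nat_mul]
  refine mul_le_mul_of_nonneg_left (Real.exp_le_exp.2 ?_) ha
  push_cast
  linarith

theorem theorem4 :
    ∀ ε : ℝ, 0 < ε → ∀ δ : ℝ, 0 < δ → ∃ q₀ : ℕ, ∀ q : ℕ, q₀ ≤ q →
      ∀ N θ : ℝ, N = (q : ℝ) ^ θ → θ < 1 - ε →
        4 * √(Real.log q * Real.log (Real.log q)) * Real.log (Real.log (Real.log q))
          < Real.log N →
        √N * Real.exp ((1 - δ) * √((1 - θ) * Real.log q / Real.log (Real.log q)))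
            ≤ charSumSup N q ∧
        (q.Prime →
          √((q : ℝ) / N) *
              Real.exp ((1 - δ) * √((1 - θ) * Real.log q / (2 * Real.log (Real.log q))))
            ≤ charSumSup ((q : ℝ) / N) q) := by
  intro ε hε δ hδ
  -- the bounds get stronger as `δ` decreases
  set d := min δ (1 / 2) with hd
  have hd0 : 0 < d := lt_min hδ (by norm_num)
  have hdδ : d ≤ δ := min_le_left _ _
  have hd1 : d ≤ 1 / 2 := min_le_right _ _
  have hev := ((exists_resonator (half_pos hε) (show 0 < d / 6 by positivity)
    (by linarith)).and (eventually_le_exp_mul_sqrt (half_pos hε) hd0)).and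
    (tendsto_log_natCast.eventually (eventually_log_conditions (max 56 (3 / ε))))
  obtain ⟨q₀, hq₀⟩ := Filter.eventually_atTop.1 hev
  refine ⟨max q₀ 3, fun q hq N θ hNθ hθ hlogN => ?_⟩
  obtain ⟨⟨hres, hexp⟩, hx1, hx2, hx3, hx4⟩ := hq₀ q ((le_max_left _ _).trans hq)
  have hq3 : 3 ≤ q := (le_max_right _ _).trans hq
  set x := Real.log q with hx
  set ℓ := Real.log x with hℓ
  have hA1 : (56 : ℝ) ≤ max 56 (3 / ε) := le_max_left _ _
  have hx0 : 0 < x := by linarith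
  have hℓ0 : 0 < ℓ := by linarith
  have hq0 : (0 : ℝ) < q := by exact_mod_cast (by omega : 0 < q)
  have hN0 : 0 < N := by rw [hNθ]; positivity
  have hlN : Real.log N = θ * x := by rw [hNθ, Real.log_rpow hq0]
  have hqexp : (q : ℝ) = Real.exp x := (Real.exp_log hq0).symm
  have hNexp : N = Real.exp (θ * x) := by rw [← hlN, Real.exp_log hN0]
  have hqN : (q : ℝ) / N = Real.exp ((1 - θ) * x) := by
    rw [hNexp, hqexp, ← Real.exp_sub]; ring_nf
  have hS : 56 ≤ √(x * ℓ) * Real.log ℓ := by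
    have h1 : 1 ≤ √(x * ℓ) := Real.one_le_sqrt.2
      (one_le_mul_of_one_le_of_one_le (by linarith) (by linarith))
    have h2 : 56 ≤ Real.log ℓ := hA1.trans hx3
    exact h2.trans (le_mul_of_one_le_left (by linarith) h1)
  have hlogN' : 4 * (√(x * ℓ) * Real.log ℓ) < Real.log N := by linarith
  have hN1 : 1 < N := (Real.log_pos_iff hN0.le).1 (by linarith)
  have hθ0 : 0 < θ := by
    have : 0 < θ * x := by rw [← hlN]; linarith
    exact pos_of_mul_pos_left this hx0.le
  have hNq : N ≤ q := by
    rw [hNθ]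
    exact (Real.rpow_le_rpow_of_exponent_le (by exact_mod_cast (by omega : 1 ≤ q))
      (show θ ≤ 1 by linarith)).trans_eq (Real.rpow_one _)
  have hεx : 3 ≤ ε * x := by
    have := (le_max_right 56 (3 / ε)).trans hx1
    rw [div_le_iff₀ hε] at this; linarith
  have hgain : ∀ u : ℝ, 0 ≤ u → 4 * x ≤ Real.exp (d * u) →
      4 * x * Real.exp (2 * ((1 - d) * u)) ≤ Real.exp (2 * (1 - 3 * (d / 6)) * u) ∧
      1 ≤ Real.exp (2 * ((1 - d) * u)) := by
    intro u hu h
    constructor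
    · rw [show 2 * (1 - 3 * (d / 6)) * u = d * u + 2 * ((1 - d) * u) by ring, Real.exp_add]
      gcongr
    · exact Real.one_le_exp (mul_nonneg (by norm_num) (mul_nonneg (by linarith) hu))
  constructor
  · have hY1 : ε / 2 * x ≤ (1 - θ) * x := by gcongr; linarith
    have hY2 : (1 - θ) * x ≤ x := by linarith [mul_pos hθ0 hx0]
    obtain ⟨M, r, V, hM, hr, hρ0, hρV, hcol, -⟩ := hres N ((1 - θ) * x) hN0 hNq
      (by linarith) hY1 hY2
    set u := √((1 - θ) * x / ℓ) with hu
    obtain ⟨hg, hg1⟩ := hgain u (Real.sqrt_nonneg _) (hexp _ hY1)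
    rw [← hqN] at hM
    have h1 := le_charSumSup_sq (by omega) hN1 hM hr hρ0 hρV (Real.exp_pos _).le hcol
    refine sqrt_mul_exp_le (c := (1 - d) * u) hN0.le (charSumSup_nonneg _ _) ?_
      (le_trans ?_ h1)
    · gcongr
    · rw [← hx]
      refine mul_le_mul_of_nonneg_left ?_ hN0.le
      have h2 := mul_nonneg (show 0 ≤ 4 * x - 1 by linarith) (sub_nonneg.2 hg1)
      linarith
  · intro hqp
    have hY1 : ε / 2 * x ≤ (1 - θ) * x / 2 := by
      have : ε * x ≤ (1 - θ) * x := by gcongr; linarith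
      linarith
    have hY2 : (1 - θ) * x / 2 ≤ x := by linarith [mul_pos hθ0 hx0]
    have hl8 : Real.log (N / 8) = Real.log N - Real.log 8 :=
      Real.log_div hN0.ne' (by norm_num)
    have hl8' : Real.log 8 ≤ 7 := by
      have := Real.log_le_sub_one_of_pos (show (0 : ℝ) < 8 by norm_num)
      linarith
    obtain ⟨M, r, V, hM, hr, hρ0, hρV, hcol, hV⟩ := hres (N / 8) ((1 - θ) * x / 2)
      (by positivity) (by linarith) (by rw [hl8]; linarith) hY1 hY2
    have hueq : (1 - θ) * x / 2 / ℓ = (1 - θ) * x / (2 * ℓ) := by rw [div_div]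
    have he := hexp _ hY1
    rw [hueq] at hcol he
    set u := √((1 - θ) * x / (2 * ℓ)) with hu
    obtain ⟨hg, hg1⟩ := hgain u (Real.sqrt_nonneg _) he
    have hsq : Real.exp ((1 - θ) * x / 2) = √((q : ℝ) / N) := by
      rw [hqN, ← Real.exp_half]
    rw [hsq] at hM
    have ht4 : 4 ≤ (q : ℝ) / N := by
      rw [hqN]
      have h1 : 3 ≤ (1 - θ) * x := by linarith
      linarith [Real.add_one_le_exp ((1 - θ) * x)]
    have hgx : 224 * Real.exp (2 * ((1 - d) * u)) ≤ 4 * x * Real.exp (2 * ((1 - d) * u)) := by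
      gcongr
      linarith
    have h20 : 20 ≤ Real.exp (2 * (1 - 3 * (d / 6)) * u) := by linarith
    have h1 := le_charSumSup_div_sq hqp hN1 ht4 (fun m hm => ⟨(hM m hm).1, (hM m hm).2.1⟩) hr hρ0
      hρV h20 hcol hV
    refine sqrt_mul_exp_le (c := (1 - d) * u) (by positivity) (charSumSup_nonneg _ _) ?_
      (le_trans ?_ h1)
    · gcongr
    · refine mul_le_mul_of_nonneg_left ?_ (by positivity)
      linarith
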